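/- Let ${\mathcal A}$ be a finite set of linear hyperplanes in $\mathbb R^d$. The regions of ${\mathcal A}$ are the closures of the connected components of $\mathbb R^d\setminus\bigcup{\mathcal A}$. Assume that ${\mathcal A}$ is simplicial: every region is the nonnegative linear span of a linearly independent set of vectors. Fix a region $B$ of ${\mathcal A}$ (the base region). For distinct $H,H'\in{\mathcal A}$, the rank-two subarrangement containing $H$ and $H'$ is $\{K\in{\mathcal A}: K\supseteq H\cap H'\}$. The basic hyperplanes of a rank-two subarrangement ${\mathcal A}'$ are the two hyperplanes of ${\mathcal A}'$ that bound the region of ${\mathcal A}'$ containing $B$. A hyperplane $H\in{\mathcal A}$ cuts a hyperplane $H'\in{\mathcal A}$, $H'\neq H$, if $H$ is basic and $H'$ is not basic in the rank-two subarrangement containing $H$ and $H'$. The shards in $H\in{\mathcal A}$ are the closures of the connected components of $H\setminus\bigcup\{H'\in{\mathcal A}: H'\text{ cuts }H\}$, and the shards of ${\mathcal A}$ are the shards in all the hyperplanes $H\in{\mathcal A}$. For a shard $\Sigma$, let $H_\Sigma$ be the hyperplane of ${\mathcal A}$ containing $\Sigma$. Two shards are compatible if their relative interiors have nonempty intersection.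 The shard digraph is the directed graph on the set of all shards with an arrow $\Sigma_1\to\Sigma_2$ if and only if $H_{\Sigma_1}$ cuts $H_{\Sigma_2}$ and $\Sigma_1\cap\Sigma_2$ has codimension $2$ in $\mathbb R^d$. Theorem. Let $\Sigma_1$ and $\Sigma_2$ be shards of ${\mathcal A}$. Then $\Sigma_1\to\Sigma_2$ in the shard digraph if and only if there exists a shard $\Sigma_1'$ satisfying all of the following conditions: (i) $\Sigma_1$ and $\Sigma_1'$ are compatible; (ii) $H_{\Sigma_1}\neq H_{\Sigma_1'}$, and $H_{\Sigma_2}$ is in the rank-two subarrangement containing $H_{\Sigma_1}$ and $H_{\Sigma_1'}$ but is not basic in that subarrangement; (iii) $\Sigma_1\cap\Sigma_1'\subseteq\Sigma_2$. -/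

import Mathlib

namespace HypArr

/-- A linear hyperplane of `ℝ^d`: a linear subspace of dimension `d - 1`. -/
def IsHyperplane {d : ℕ} (H : Submodule ℝ (EuclideanSpace ℝ (Fin d))) : Prop :=
  Module.finrank ℝ H + 1 = d

/-- A (real, central) hyperplane arrangement: a finite set of linear hyperplanes of `ℝ^d`. -/
structure IsArrangement {d : ℕ} (A : Set (Submodule ℝ (EuclideanSpace ℝ (Fin d)))) : Prop where
  finite : A.Finite
  isHyperplane : ∀ H ∈ A, IsHyperplane H

/-- The complement in `ℝ^d` of the union of the hyperplanes of `A`. -/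
def complement {d : ℕ} (A : Set (Submodule ℝ (EuclideanSpace ℝ (Fin d)))) :
    Set (EuclideanSpace ℝ (Fin d)) :=
  {x | ∀ H ∈ A, x ∉ H}

/-- The regions of `A`: the closures of the connected components of the complement of `A`. -/
def IsRegion {d : ℕ} (A : Set (Submodule ℝ (EuclideanSpace ℝ (Fin d))))
    (R : Set (EuclideanSpace ℝ (Fin d))) : Prop :=
  ∃ x ∈ complement A, R = closure (connectedComponentIn (complement A) x)

/-- A simplicial cone: the nonnegative linear span of a linearly independent set of vectors. -/
def IsSimplicialCone {d : ℕ} (R : Set (EuclideanSpace ℝ (Fin d))) : Prop :=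
  ∃ s : Set (EuclideanSpace ℝ (Fin d)), LinearIndepOn ℝ id s ∧
    R = (PointedCone.hull ℝ s : Set (EuclideanSpace ℝ (Fin d)))

/-- An arrangement is simplicial if each of its regions is a simplicial cone. -/
def IsSimplicial {d : ℕ} (A : Set (Submodule ℝ (EuclideanSpace ℝ (Fin d)))) : Prop :=
  ∀ R, IsRegion A R → IsSimplicialCone R

/-- The (convex) set `S` has codimension `k` in `ℝ^d`: its affine hull has dimension `d - k`. -/
def HasCodim {d : ℕ} (S : Set (EuclideanSpace ℝ (Fin d))) (k : ℕ) : Prop :=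
  S.Nonempty ∧ Module.finrank ℝ (affineSpan ℝ S).direction + k = d

/-- A rank-two subarrangement of `A`: a subset with more than one element, consisting of all the
hyperplanes of `A` that contain a given linear subspace of codimension two. -/
def IsRankTwoSubarrangement {d : ℕ} (A A' : Set (Submodule ℝ (EuclideanSpace ℝ (Fin d)))) :
    Prop :=
  A'.Nontrivial ∧ ∃ U : Submodule ℝ (EuclideanSpace ℝ (Fin d)),
    Module.finrank ℝ U + 2 = d ∧ A' = {H ∈ A | U ≤ H}

/-- For distinct `H₁, H₂` in `A`, the rank-two subarrangement of `A` containing `H₁` and `H₂`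
(see `isRankTwoSubarrangement_rankTwo` and `eq_rankTwo`). -/
def rankTwo {d : ℕ} (A : Set (Submodule ℝ (EuclideanSpace ℝ (Fin d))))
    (H₁ H₂ : Submodule ℝ (EuclideanSpace ℝ (Fin d))) :
    Set (Submodule ℝ (EuclideanSpace ℝ (Fin d))) :=
  {H ∈ A | H₁ ⊓ H₂ ≤ H}

theorem finrank_inf_add_two {d : ℕ} {H₁ H₂ : Submodule ℝ (EuclideanSpace ℝ (Fin d))}
    (h₁ : IsHyperplane H₁) (h₂ : IsHyperplane H₂) (hne : H₁ ≠ H₂) :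
    Module.finrank ℝ (H₁ ⊓ H₂ : Submodule ℝ (EuclideanSpace ℝ (Fin d))) + 2 = d := by
  unfold IsHyperplane at h₁ h₂
  have hd : Module.finrank ℝ (EuclideanSpace ℝ (Fin d)) = d := by simp
  have hle := Submodule.finrank_le (H₁ ⊔ H₂)
  have hsum := Submodule.finrank_sup_add_finrank_inf_eq H₁ H₂
  have hlt : Module.finrank ℝ H₁ <
      Module.finrank ℝ (H₁ ⊔ H₂ : Submodule ℝ (EuclideanSpace ℝ (Fin d))) := by
    apply Submodule.finrank_lt_finrank_of_lt
    refine lt_of_le_of_ne le_sup_left fun h => hne ?_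
    have h21 : H₂ ≤ H₁ := by rw [h]; exact le_sup_right
    exact (Submodule.eq_of_le_of_finrank_eq h21 (by omega)).symm
  omega

theorem isRankTwoSubarrangement_rankTwo {d : ℕ}
    {A : Set (Submodule ℝ (EuclideanSpace ℝ (Fin d)))} (hA : IsArrangement A)
    {H₁ H₂ : Submodule ℝ (EuclideanSpace ℝ (Fin d))} (h₁ : H₁ ∈ A) (h₂ : H₂ ∈ A)
    (hne : H₁ ≠ H₂) : IsRankTwoSubarrangement A (rankTwo A H₁ H₂) :=
  ⟨⟨H₁, ⟨h₁, inf_le_left⟩, H₂, ⟨h₂, inf_le_right⟩, hne⟩, H₁ ⊓ H₂,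
    finrank_inf_add_two (hA.isHyperplane _ h₁) (hA.isHyperplane _ h₂) hne, rfl⟩

theorem eq_rankTwo {d : ℕ}
    {A A' : Set (Submodule ℝ (EuclideanSpace ℝ (Fin d)))} (hA : IsArrangement A)
    (hA' : IsRankTwoSubarrangement A A')
    {H₁ H₂ : Submodule ℝ (EuclideanSpace ℝ (Fin d))} (h₁ : H₁ ∈ A') (h₂ : H₂ ∈ A')
    (hne : H₁ ≠ H₂) : A' = rankTwo A H₁ H₂ := by
  obtain ⟨-, U, hU, rfl⟩ := hA'
  have hf := finrank_inf_add_two (hA.isHyperplane _ h₁.1) (hA.isHyperplane _ h₂.1) hne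
  have : U = H₁ ⊓ H₂ := Submodule.eq_of_le_of_finrank_eq (le_inf h₁.2 h₂.2) (by omega)
  rw [this]; rfl

/-- `H` is basic in the (rank-two) subarrangement `A'` with respect to the base region `B`:
`H ∈ A'` and `H` bounds the region `B'` of `A'` that contains `B`, that is, `H ∩ B'` is a facet
of `B'`. -/
def IsBasic {d : ℕ} (A' : Set (Submodule ℝ (EuclideanSpace ℝ (Fin d))))
    (B : Set (EuclideanSpace ℝ (Fin d))) (H : Submodule ℝ (EuclideanSpace ℝ (Fin d))) : Prop :=
  H ∈ A' ∧ ∃ B', IsRegion A' B' ∧ B ⊆ B' ∧ HasCodim ((H : Set (EuclideanSpace ℝ (Fin d))) ∩ B') 1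

/-- `H₁` cuts `H₂`: in the rank-two subarrangement containing the two (distinct) hyperplanes,
`H₁` is basic and `H₂` is not. -/
def Cuts {d : ℕ} (A : Set (Submodule ℝ (EuclideanSpace ℝ (Fin d))))
    (B : Set (EuclideanSpace ℝ (Fin d))) (H₁ H₂ : Submodule ℝ (EuclideanSpace ℝ (Fin d))) :
    Prop :=
  H₁ ∈ A ∧ H₂ ∈ A ∧ H₁ ≠ H₂ ∧ IsBasic (rankTwo A H₁ H₂) B H₁ ∧ ¬ IsBasic (rankTwo A H₁ H₂) B H₂

/-- The part of `H` that remains after removing all the hyperplanes of `A` that cut `H`. -/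
def uncut {d : ℕ} (A : Set (Submodule ℝ (EuclideanSpace ℝ (Fin d))))
    (B : Set (EuclideanSpace ℝ (Fin d))) (H : Submodule ℝ (EuclideanSpace ℝ (Fin d))) :
    Set (EuclideanSpace ℝ (Fin d)) :=
  {x | x ∈ H ∧ ∀ H', Cuts A B H' H → x ∉ H'}

/-- A shard of `A` (with respect to the base region `B`): a hyperplane `H` of `A` together with
the closure of a connected component of `H` minus the hyperplanes that cut `H`. The field
`hyperplane` is `H_Σ`; it is the linear span of the shard, hence determined by the shard as
a set. -/
@[ext]
structure Shard {d : ℕ} (A : Set (Submodule ℝ (EuclideanSpace ℝ (Fin d))))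
    (B : Set (EuclideanSpace ℝ (Fin d))) where
  hyperplane : Submodule ℝ (EuclideanSpace ℝ (Fin d))
  carrier : Set (EuclideanSpace ℝ (Fin d))
  hyperplane_mem : hyperplane ∈ A
  isComponent : ∃ x ∈ uncut A B hyperplane,
    carrier = closure (connectedComponentIn (uncut A B hyperplane) x)

/-- Two shards are compatible if their relative interiors meet. -/
def Shard.Compatible {d : ℕ} {A : Set (Submodule ℝ (EuclideanSpace ℝ (Fin d)))}
    {B : Set (EuclideanSpace ℝ (Fin d))} (S T : Shard A B) : Prop :=
  (intrinsicInterior ℝ S.carrier ∩ intrinsicInterior ℝ T.carrier).Nonempty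

/-- The shard digraph: `Σ₁ → Σ₂` if and only if `H_{Σ₁}` cuts `H_{Σ₂}` and `Σ₁ ∩ Σ₂` has
codimension two. -/
def shardDigraph {d : ℕ} (A : Set (Submodule ℝ (EuclideanSpace ℝ (Fin d))))
    (B : Set (EuclideanSpace ℝ (Fin d))) : Digraph (Shard A B) where
  Adj S T := Cuts A B S.hyperplane T.hyperplane ∧ HasCodim (S.carrier ∩ T.carrier) 2

end HypArr

/-!
Normalise the normal functionals `ν H` to be `1` at an interior point `b` of the base region. A
rank-two subarrangement then becomes a set of points on a line in the dual space, and its basic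
hyperplanes are the two ends of that line.

Let `z` be a point of both `H₁` and `H₁'` that lies on no hyperplane cutting either of them, and
consider the hyperplanes of the arrangement through `z`. Among these, `ν H₁` and `ν H₁'` lie in no
open segment spanned by two other normals. In a simplicial arrangement this makes them simple roots
of the chamber containing `b`: walking along the facets in `H₁`, the one with the fewest negative
normals must bound that chamber. Hence the normals vanishing on `H₁ ∩ H₁'` are exactly those of a
face of the chamber. So if `K` passes through `z` and cuts a member `H₂` of the rank-two
subarrangement of `H₁` and `H₁'`, then `ν H₂` lies in an open segment starting at `ν K`, and `ν K`
belongs to the face as well: `K` contains `H₁ ∩ H₁'`.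

Let `Σ₁` and `Σ₁'` be shards in `H₁` and `H₁'` with a common relative interior point `x` in a shard
`Σ₂` in `H₂`. A segment from `x` to a point `y` of `Σ₁ ∩ Σ₁'` avoids the hyperplanes that cut `H₁`
or `H₁'`. If `y` were not in `Σ₂`, the segment would meet some `K` that cuts `H₂` and does not
contain `y`, contradicting the previous paragraph. Given an arrow `Σ₁ → Σ₂`, apply this to a generic
`x` in `Σ₁ ∩ Σ₂` and the shard `Σ₁'` through `x` in the second basic hyperplane. Conversely, in the
presence of (i)-(iii) the cells of `Σ₁` and `Σ₁'` around `x` cut out a subset of `Σ₁ ∩ Σ₂` that is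
relatively open in `H₁ ∩ H₁'`.
-/

namespace HypArr

open Module (Dual)

theorem finite_setOf_mem_or_neg_mem {G : Type*} [InvolutiveNeg G] {S : Set G} (hS : S.Finite) :
    {g | g ∈ S ∨ -g ∈ S}.Finite :=
  hS.union (hS.preimage neg_injective.injOn)

theorem eq_of_ker_le_ker {R M : Type*} [CommRing R] [AddCommGroup M] [Module R M]
    {α ψ : Dual R M} {b : M} (hα : α b = 1) (hψ : ψ b = 1)
    (h : LinearMap.ker α ≤ LinearMap.ker ψ) : ψ = α := by
  ext v
  have hv : v - α v • b ∈ LinearMap.ker ψ := h (by simp [hα])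
  simpa [hψ, sub_eq_zero] using hv

theorem exists_eq_lineMap_of_ker_inf_ker_le {𝕜 V : Type*} [Field 𝕜] [AddCommGroup V] [Module 𝕜 V]
    {α β ψ : Dual 𝕜 V} {b : V} (hα : α b = 1) (hβ : β b = 1) (hψ : ψ b = 1)
    (h : LinearMap.ker α ⊓ LinearMap.ker β ≤ LinearMap.ker ψ) :
    ∃ t : 𝕜, ψ = AffineMap.lineMap α β t := by
  have hker : ⨅ i, LinearMap.ker (![α, β] i) ≤ LinearMap.ker ψ :=
    (le_inf (iInf_le _ 0) (iInf_le _ 1)).trans h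
  have hspan := mem_span_of_iInf_ker_le_ker hker
  rw [Matrix.range_cons_cons_empty, Submodule.mem_span_pair] at hspan
  obtain ⟨c, t, rfl⟩ := hspan
  have hct : c = 1 - t := by
    simp only [LinearMap.add_apply, LinearMap.smul_apply, hα, hβ, smul_eq_mul, mul_one] at hψ
    linear_combination hψ
  exact ⟨t, by rw [AffineMap.lineMap_apply_module, hct]⟩

/-! ### Simple systems -/

section SimpleSystems

variable {𝕜 V : Type*} [Field 𝕜] [AddCommGroup V] [Module 𝕜 V]

theorem subsingleton_lineMap_mem {x y : V} {K : Submodule 𝕜 V} (h : x ∉ K ∨ y ∉ K) :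
    {t : 𝕜 | AffineMap.lineMap x y t ∈ K}.Subsingleton := by
  intro s hs t ht
  by_contra hst
  simp only [Set.mem_ofPred_eq, AffineMap.lineMap_apply_module'] at hs ht
  have hyx : y - x ∈ K := by
    have hsub := K.sub_mem hs ht
    rwa [add_sub_add_right_eq_sub, ← sub_smul, K.smul_mem_iff (sub_ne_zero.2 hst)] at hsub
  have hx : x ∈ K := (K.add_mem_iff_right (K.smul_mem s hyx)).1 hs
  exact h.elim (· hx) (· ((K.sub_mem_iff_left hx).1 hyx))

variable [LinearOrder 𝕜]

/-- The positive roots of a set `Ψ` of functionals at a point `x`: each functional of `Ψ`, with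
the sign that makes it positive at `x`. -/
def positiveRoots (Ψ : Set (Dual 𝕜 V)) (x : V) : Set (Dual 𝕜 V) :=
  {φ | (φ ∈ Ψ ∨ -φ ∈ Ψ) ∧ 0 < φ x}

theorem finite_positiveRoots {Ψ : Set (Dual 𝕜 V)} (hΨ : Ψ.Finite) (x : V) :
    (positiveRoots Ψ x).Finite :=
  (finite_setOf_mem_or_neg_mem hΨ).subset fun _ h => h.1

variable [IsStrictOrderedRing 𝕜]

theorem positiveRoots_eq_self {Ψ : Set (Dual 𝕜 V)} {x : V} (hx : ∀ ψ ∈ Ψ, 0 < ψ x) :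
    positiveRoots Ψ x = Ψ := by
  ext φ
  exact ⟨fun ⟨h, hpos⟩ => h.resolve_right fun hneg => hpos.not_gt (neg_pos.1 (hx _ hneg)),
    fun h => ⟨.inl h, hx φ h⟩⟩

theorem exists_mem_forall_notMem_of_convex {C : Set V} (hC : Convex 𝕜 C) (hne : C.Nonempty)
    {T : Set (Submodule 𝕜 V)} (hT : T.Finite) (h : ∀ K ∈ T, ¬ C ⊆ K) :
    ∃ x ∈ C, ∀ K ∈ T, x ∉ K := by
  induction T, hT using Set.Finite.induction_on with
  | empty => exact hne.imp fun x hx => ⟨hx, by simp⟩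
  | @insert K T _ hT ih =>
    obtain ⟨x, hxC, hx⟩ := ih fun L hL => h L (Set.mem_insert_of_mem _ hL)
    obtain ⟨y, hyC, hyK⟩ := Set.not_subset.1 (h K (Set.mem_insert _ _))
    have hbad : (⋃ L ∈ insert K T, {t : 𝕜 | AffineMap.lineMap x y t ∈ L}).Finite :=
      (hT.insert K).biUnion fun L hL => (subsingleton_lineMap_mem <|
        hL.elim (fun hLK => .inr (hLK ▸ hyK)) (fun hLT => .inl (hx L hLT))).finite
    obtain ⟨t, ht, htbad⟩ := (Set.Ioo_infinite (zero_lt_one (α := 𝕜))).exists_notMem_finite hbad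
    exact ⟨AffineMap.lineMap x y t, hC.lineMap_mem hxC hyC ⟨ht.1.le, ht.2.le⟩,
      fun L hL hmem => htbad (Set.mem_biUnion hL hmem)⟩

theorem exists_pos_forall_apply_add_smul_pos {Φ : Set (Dual 𝕜 V)} (hΦ : Φ.Finite) (z v : V) :
    ∃ ε > (0 : 𝕜), ∀ φ ∈ Φ, 0 < φ z → 0 < φ (z + ε • v) := by
  suffices h : ∃ ε > (0 : 𝕜), ∀ φ ∈ Φ, 0 < φ z → ε * |φ v| < φ z by
    obtain ⟨ε, hε, h⟩ := h
    refine ⟨ε, hε, fun φ hφ hz => ?_⟩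
    have hlt := h φ hφ hz
    rw [map_add, map_smul, smul_eq_mul]
    nlinarith [neg_abs_le (φ v)]
  induction Φ, hΦ using Set.Finite.induction_on with
  | empty => exact ⟨1, one_pos, by simp⟩
  | @insert ψ Φ _ _ ih =>
    obtain ⟨ε, hε, hΦ⟩ := ih
    rcases le_or_gt (ψ z) 0 with hψ | hψ
    · exact ⟨ε, hε, Set.forall_mem_insert.2 ⟨fun h => absurd h hψ.not_gt, hΦ⟩⟩
    have hpos : 0 < |ψ v| + 1 := by positivity
    refine ⟨min ε (ψ z / (|ψ v| + 1)), by positivity, Set.forall_mem_insert.2 ⟨fun _ => ?_,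
      fun φ hφ hz => lt_of_le_of_lt ?_ (hΦ φ hφ hz)⟩⟩
    · calc min ε (ψ z / (|ψ v| + 1)) * |ψ v| ≤ ψ z / (|ψ v| + 1) * |ψ v| := by
            gcongr; exact min_le_right _ _
        _ < ψ z / (|ψ v| + 1) * (|ψ v| + 1) := by gcongr; exact lt_add_one _
        _ = ψ z := div_mul_cancel₀ _ hpos.ne'
    · gcongr; exact min_le_left _ _

theorem exists_pos_forall_sign_apply_add_smul {Ψ : Set (Dual 𝕜 V)} (hΨ : Ψ.Finite) (z v : V) :
    ∃ ε > (0 : 𝕜), ∀ ψ ∈ Ψ,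
      (0 < ψ z → 0 < ψ (z + ε • v)) ∧ (ψ z < 0 → ψ (z + ε • v) < 0) := by
  obtain ⟨ε, hε, h⟩ :=
    exists_pos_forall_apply_add_smul_pos (finite_setOf_mem_or_neg_mem hΨ) z v
  exact ⟨ε, hε, fun ψ hψ => ⟨h ψ (.inl hψ), fun hz =>
    neg_pos.1 (h (-ψ) (.inr ((neg_neg ψ).symm ▸ hψ)) (neg_pos.2 hz))⟩⟩

theorem apply_nonneg_of_mem_hull {s : Set V} {f : Dual 𝕜 V} (hf : ∀ v ∈ s, 0 ≤ f v) {y : V}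
    (hy : y ∈ PointedCone.hull 𝕜 s) : 0 ≤ f y := by
  induction hy using Submodule.span_induction with
  | mem v hv => exact hf v hv
  | zero => rw [map_zero]
  | add u v _ _ hu hv => rw [map_add]; exact add_nonneg hu hv
  | smul c v _ hv => rw [Nonneg.mk_smul, map_smul]; exact mul_nonneg c.2 hv

theorem mem_hull_sep_of_apply_eq_zero {s : Set V} {f : Dual 𝕜 V} (hf : ∀ v ∈ s, 0 ≤ f v) {y : V}
    (hy : y ∈ PointedCone.hull 𝕜 s) (h0 : f y = 0) :
    y ∈ PointedCone.hull 𝕜 {v ∈ s | f v = 0} := by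
  induction hy using Submodule.span_induction with
  | mem v hv => exact Submodule.subset_span ⟨hv, h0⟩
  | zero => exact zero_mem _
  | add u v hu hv ihu ihv =>
    rw [map_add, add_eq_zero_iff_of_nonneg (apply_nonneg_of_mem_hull hf hu)
      (apply_nonneg_of_mem_hull hf hv)] at h0
    exact add_mem (ihu h0.1) (ihv h0.2)
  | smul c v _ ih =>
    rw [Nonneg.mk_smul, map_smul, smul_eq_mul, mul_eq_zero] at h0
    rcases h0 with hc | hv
    · rw [Nonneg.mk_smul, hc, zero_smul]; exact zero_mem _
    · exact Submodule.smul_mem _ c (ih hv)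

/-- A simple system of a set `P` of functionals, as for root systems: linearly independent
elements of `P` such that all of `P` consists of nonnegative combinations of them. -/
structure IsSimpleSystem (P Δ : Set (Dual 𝕜 V)) : Prop where
  subset : Δ ⊆ P
  linearIndepOn : LinearIndepOn 𝕜 id Δ
  subset_hull : P ⊆ PointedCone.hull 𝕜 Δ

/-- Every chamber of the central arrangement `{ker ψ | ψ ∈ Ψ}` has a simple system of positive
roots. This is the dual form of simpliciality. -/
def HasSimpleSystems (Ψ : Set (Dual 𝕜 V)) : Prop :=
  ∀ x, (∀ ψ ∈ Ψ, ψ x ≠ 0) → ∃ Δ, IsSimpleSystem (positiveRoots Ψ x) Δ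

variable {Ψ P Δ : Set (Dual 𝕜 V)}

theorem IsSimpleSystem.sep_apply_eq_zero (hΔ : IsSimpleSystem P Δ) {z : V}
    (hz : ∀ φ ∈ P, 0 ≤ φ z) : IsSimpleSystem {φ ∈ P | φ z = 0} {δ ∈ Δ | δ z = 0} where
  subset _ h := ⟨hΔ.subset h.1, h.2⟩
  linearIndepOn := hΔ.linearIndepOn.mono (Set.sep_subset _ _)
  subset_hull _ hφ := mem_hull_sep_of_apply_eq_zero (f := Dual.eval 𝕜 V z)
    (fun δ hδ => hz δ (hΔ.subset hδ)) (hΔ.subset_hull hφ.1) hφ.2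

theorem HasSimpleSystems.sep_apply_eq_zero (h : HasSimpleSystems Ψ) (hΨ : Ψ.Finite) (z : V) :
    HasSimpleSystems {ψ ∈ Ψ | ψ z = 0} := by
  intro x hx
  obtain ⟨ε, hε, hsign⟩ := exists_pos_forall_sign_apply_add_smul hΨ z x
  have hzero : ∀ φ : Dual 𝕜 V, φ z = 0 → φ (z + ε • x) = ε * φ x := fun φ hφz => by simp [hφz]
  obtain ⟨Δ, hΔ⟩ := h (z + ε • x) fun ψ hψ => by
    rcases lt_trichotomy (ψ z) 0 with hlt | heq | hgt
    · exact ((hsign ψ hψ).2 hlt).ne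
    · rw [hzero ψ heq]; exact mul_ne_zero hε.ne' (hx ψ ⟨hψ, heq⟩)
    · exact ((hsign ψ hψ).1 hgt).ne'
  have hz : ∀ φ ∈ positiveRoots Ψ (z + ε • x), 0 ≤ φ z := by
    rintro φ ⟨hφ | hφ, hpos⟩
    · exact not_lt.1 fun hlt => ((hsign φ hφ).2 hlt).not_gt hpos
    · exact not_lt.1 fun hlt => ((hsign _ hφ).1 (neg_pos.2 hlt)).not_gt (neg_neg_iff_pos.2 hpos)
  have hroots : {φ ∈ positiveRoots Ψ (z + ε • x) | φ z = 0} =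
      positiveRoots {ψ ∈ Ψ | ψ z = 0} x := by
    ext φ
    have : φ z = 0 → (0 < φ (z + ε • x) ↔ 0 < φ x) := fun hφz => by
      rw [hzero φ hφz, mul_pos_iff_of_pos_left hε]
    simp only [positiveRoots, Set.mem_ofPred_eq, LinearMap.neg_apply, neg_eq_zero]
    tauto
  exact ⟨_, hroots ▸ hΔ.sep_apply_eq_zero hz⟩

theorem IsSimpleSystem.mem_of_wall (hΔ : IsSimpleSystem P Δ) {α : Dual 𝕜 V} (hα : α ∈ P)
    (hα0 : α ≠ 0) {p : V} (hαp : α p = 0) (hp : ∀ φ ∈ P, φ ≠ α → 0 < φ p) : α ∈ Δ := by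
  by_contra hαΔ
  have hp0 : ∀ φ ∈ P, 0 ≤ φ p := fun φ hφ =>
    (eq_or_ne φ α).elim (fun h => h ▸ hαp.ge) fun h => (hp φ hφ h).le
  have hmem := (hΔ.sep_apply_eq_zero hp0).subset_hull ⟨hα, hαp⟩
  have hempty : {δ ∈ Δ | δ p = 0} = ∅ := Set.sep_eq_empty_iff_mem_false.2 fun δ hδ =>
    (hp δ (hΔ.subset hδ) (ne_of_mem_of_not_mem hδ hαΔ)).ne'
  rw [hempty] at hmem
  exact hα0 (by simpa using hmem)

theorem IsSimpleSystem.exists_face_point [Module.IsReflexive 𝕜 V]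
    (hΔ : IsSimpleSystem P Δ) {Δ' : Set (Dual 𝕜 V)} (hΔ' : Δ' ⊆ Δ) :
    ∃ f : V, (∀ φ ∈ P, 0 ≤ φ f) ∧ (∀ δ ∈ Δ', δ f = 0) ∧
      ∀ φ ∈ P, φ f = 0 → φ ∈ PointedCone.hull 𝕜 Δ' := by
  classical
  let e := Module.Basis.extend hΔ.linearIndepOn
  let f : V := (Module.evalEquiv 𝕜 V).symm
    (e.constr 𝕜 fun δ => if (δ : Dual 𝕜 V) ∈ Δ' then 0 else 1)
  have hf : ∀ δ ∈ Δ, δ f = if δ ∈ Δ' then 0 else 1 := fun δ hδ => by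
    let i : hΔ.linearIndepOn.extend (Set.subset_univ Δ) :=
      ⟨δ, hΔ.linearIndepOn.subset_extend _ hδ⟩
    have hi : e i = δ := Module.Basis.extend_apply_self _ i
    rw [Module.apply_evalEquiv_symm_apply]
    nth_rw 1 [← hi]
    exact e.constr_basis _ _ _
  have hsep : {δ ∈ Δ | δ f = 0} ⊆ Δ' := fun δ hδ => by
    by_contra hδ'
    simpa [hf δ hδ.1, hδ'] using hδ.2
  have hnonneg : ∀ φ ∈ P, 0 ≤ φ f := fun φ hφ =>
    apply_nonneg_of_mem_hull (f := Dual.eval 𝕜 V f)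
      (fun δ hδ => by rw [Dual.eval_apply, hf δ hδ]; split_ifs <;> simp) (hΔ.subset_hull hφ)
  exact ⟨f, hnonneg, fun δ hδ => by rw [hf δ (hΔ' hδ), if_pos hδ],
    fun φ hφ h0 => Submodule.span_mono hsep ((hΔ.sep_apply_eq_zero hnonneg).subset_hull ⟨hφ, h0⟩)⟩

theorem mem_openSegment_of_mem_hull_pair {α β ψ : Dual 𝕜 V} {b : V} (hα : α b = 1) (hβ : β b = 1)
    (hψ : ψ b = 1) (h : ψ ∈ PointedCone.hull 𝕜 {α, -β}) (hne : ψ ≠ α) :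
    α ∈ openSegment 𝕜 ψ β := by
  obtain ⟨⟨c, _⟩, ⟨t, ht⟩, hsum⟩ := Submodule.mem_span_pair.1 h
  simp only [Nonneg.mk_smul, smul_neg] at hsum
  have hc : c = 1 + t := by
    have hb := LinearMap.congr_fun hsum b
    simp only [LinearMap.add_apply, LinearMap.neg_apply, LinearMap.smul_apply, hα, hβ, hψ,
      smul_eq_mul, mul_one] at hb
    linear_combination hb
  have ht0 : t ≠ 0 := fun h0 => hne (by simp [← hsum, hc, h0])
  have : 0 < t := lt_of_le_of_ne ht ht0.symm
  have h1t : 1 + t ≠ 0 := by positivity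
  refine ⟨1 / (1 + t), t / (1 + t), by positivity, by positivity, by field_simp, ?_⟩
  rw [← hsum, hc]
  match_scalars
  · field_simp
  · field_simp; ring

theorem exists_apply_eq_zero_and_ne_zero (hΨ : Ψ.Finite) {b : V} (hb : ∀ ψ ∈ Ψ, ψ b = 1)
    {α : Dual 𝕜 V} (hα : α ∈ Ψ) : ∃ p, α p = 0 ∧ ∀ ψ ∈ Ψ, ψ ≠ α → ψ p ≠ 0 := by
  obtain ⟨p, hp, hΨp⟩ := exists_mem_forall_notMem_of_convex (LinearMap.ker α).convex
    ⟨0, zero_mem _⟩ ((hΨ.sdiff (t := {α})).image LinearMap.ker) <| by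
      rintro _ ⟨ψ, ⟨hψ, hψα⟩, rfl⟩ hle
      exact hψα (eq_of_ker_le_ker (hb α hα) (hb ψ hψ) hle)
  exact ⟨p, hp, fun ψ hψ hψα h0 => hΨp _ ⟨ψ, ⟨hψ, hψα⟩, rfl⟩ h0⟩

theorem HasSimpleSystems.exists_isSimpleSystem_of_facet_point (hsimple : HasSimpleSystems Ψ)
    (hΨ : Ψ.Finite) {α : Dual 𝕜 V} (hα : α ∈ Ψ) {b p : V} (hαb : 0 < α b) (hαp : α p = 0)
    (hp : ∀ ψ ∈ Ψ, ψ ≠ α → ψ p ≠ 0) :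
    ∃ x Δ, IsSimpleSystem (positiveRoots Ψ x) Δ ∧ α ∈ Δ ∧
      ∀ ψ ∈ Ψ, (0 < ψ p → 0 < ψ x) ∧ (ψ p < 0 → ψ x < 0) := by
  obtain ⟨ε, hε, hsign⟩ := exists_pos_forall_sign_apply_add_smul hΨ p b
  have hαx : 0 < α (p + ε • b) := by simp [hαp, mul_pos hε hαb]
  obtain ⟨Δ, hΔ⟩ := hsimple (p + ε • b) fun ψ hψ => by
    rcases eq_or_ne ψ α with rfl | hψα
    · exact hαx.ne'
    · exact (hp ψ hψ hψα).lt_or_gt.elim (fun h => ((hsign ψ hψ).2 h).ne)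
        fun h => ((hsign ψ hψ).1 h).ne'
  refine ⟨_, Δ, hΔ, hΔ.mem_of_wall ⟨.inl hα, hαx⟩ (fun h => by simp [h] at hαb) hαp ?_, hsign⟩
  rintro φ ⟨hφ | hφ, hpos⟩ hφα
  · exact (hp φ hφ hφα).lt_or_gt.resolve_left fun h => ((hsign φ hφ).2 h).not_gt hpos
  · have hne : -φ ≠ α := fun h => hαx.not_gt (h ▸ neg_neg_iff_pos.2 hpos)
    exact neg_neg_iff_pos.1 <| (hp _ hφ hne).lt_or_gt.resolve_right fun h =>
      ((hsign _ hφ).1 h).not_gt (neg_neg_iff_pos.2 hpos)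

theorem IsSimpleSystem.exists_neg_mem {x b : V} (hΔ : IsSimpleSystem (positiveRoots Ψ x) Δ)
    (hb : ∀ ψ ∈ Ψ, 0 < ψ b) {β : Dual 𝕜 V} (hβ : β ∈ Ψ) (hβx : β x < 0) :
    ∃ γ ∈ Ψ, -γ ∈ Δ := by
  by_contra! hΨ
  have hΔb : ∀ δ ∈ Δ, 0 ≤ Dual.eval 𝕜 V b δ := fun δ hδ =>
    (hb δ ((hΔ.subset hδ).1.resolve_right fun h => hΨ _ h ((neg_neg δ).symm ▸ hδ))).le
  have hβneg : -β ∈ positiveRoots Ψ x := ⟨.inr ((neg_neg β).symm ▸ hβ), neg_pos.2 hβx⟩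
  exact (neg_neg_iff_pos.2 (hb β hβ)).not_ge
    (apply_nonneg_of_mem_hull hΔb (hΔ.subset_hull hβneg))

/- The simple roots `α` and `-γ` span a codimension-two face of the chamber beyond `p`. Reflecting
the facet point `p` through it stays in `ker α` and moves to the positive side of `γ`. No other
functional becomes negative: one vanishing on that face would place `α` in a segment. -/
theorem IsSimpleSystem.exists_facet_point_ssubset [Module.IsReflexive 𝕜 V] {x : V}
    (hΔ : IsSimpleSystem (positiveRoots Ψ x) Δ) (hΨ : Ψ.Finite) {b : V} (hb : ∀ ψ ∈ Ψ, ψ b = 1)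
    {α γ : Dual 𝕜 V} (hα : α ∈ Ψ) (hγ : γ ∈ Ψ) (hαΔ : α ∈ Δ) (hγΔ : -γ ∈ Δ)
    (hseg : ∀ β ∈ Ψ, ∀ γ ∈ Ψ, β ≠ α → γ ≠ α → α ∉ openSegment 𝕜 β γ) {p : V} (hαp : α p = 0)
    (hp : ∀ ψ ∈ Ψ, ψ ≠ α → ψ p ≠ 0)
    (hx : ∀ ψ ∈ Ψ, (0 < ψ p → 0 < ψ x) ∧ (ψ p < 0 → ψ x < 0)) :
    ∃ q, α q = 0 ∧ (∀ ψ ∈ Ψ, ψ ≠ α → ψ q ≠ 0) ∧ {ψ ∈ Ψ | ψ q < 0} ⊂ {ψ ∈ Ψ | ψ p < 0} := by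
  have hγx : γ x < 0 := neg_pos.1 (hΔ.subset hγΔ).2
  have hγα : γ ≠ α := fun h => hγx.not_gt (h ▸ (hΔ.subset hαΔ).2)
  have hγp : γ p < 0 :=
    (hp γ hγ hγα).lt_or_gt.resolve_right fun h => ((hx γ hγ).1 h).not_gt hγx
  obtain ⟨f, hf, hf0, hf_mem⟩ := hΔ.exists_face_point
    (Set.insert_subset hαΔ (Set.singleton_subset_iff.2 hγΔ))
  obtain ⟨η, hη, hsign⟩ := exists_pos_forall_sign_apply_add_smul hΨ f (-p)
  have hzero : ∀ ψ : Dual 𝕜 V, ψ f = 0 → ψ (f + η • -p) = -(η * ψ p) := fun ψ h => by simp [h]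
  have hq_pos : ∀ ψ ∈ Ψ, ψ ≠ α → 0 < ψ p → 0 < ψ (f + η • -p) := fun ψ hψ hψα hψp => by
    have hψ_root : ψ ∈ positiveRoots Ψ x := ⟨.inl hψ, (hx ψ hψ).1 hψp⟩
    refine (hsign ψ hψ).1 ((hf ψ hψ_root).lt_of_ne fun h => ?_)
    exact hseg ψ hψ γ hγ hψα hγα <|
      mem_openSegment_of_mem_hull_pair (hb α hα) (hb γ hγ) (hb ψ hψ) (hf_mem ψ hψ_root h.symm) hψα
  have hq_ne : ∀ ψ ∈ Ψ, ψ p < 0 → ψ (f + η • -p) ≠ 0 := fun ψ hψ hψp => by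
    have hψ_root : -ψ ∈ positiveRoots Ψ x :=
      ⟨.inr ((neg_neg ψ).symm ▸ hψ), neg_pos.2 ((hx ψ hψ).2 hψp)⟩
    rcases (neg_nonneg.1 (hf _ hψ_root)).lt_or_eq with h | h
    · exact ((hsign ψ hψ).2 h).ne
    · rw [hzero ψ h]; exact (neg_pos.2 (mul_neg_of_pos_of_neg hη hψp)).ne'
  have hγq : 0 < γ (f + η • -p) := by
    rw [hzero γ (neg_eq_zero.1 (hf0 (-γ) (.inr rfl)))]
    exact neg_pos.2 (mul_neg_of_pos_of_neg hη hγp)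
  have hαq : α (f + η • -p) = 0 := by
    rw [hzero α (hf0 α (.inl rfl)), hαp, mul_zero, neg_zero]
  refine ⟨f + η • -p, hαq, fun ψ hψ hψα => (hp ψ hψ hψα).lt_or_gt.elim (hq_ne ψ hψ)
    fun h => (hq_pos ψ hψ hψα h).ne', ?_⟩
  refine ⟨fun ψ hψ => ⟨hψ.1, ?_⟩, fun h => hγq.not_gt (h ⟨hγ, hγp⟩).2⟩
  have hψα : ψ ≠ α := fun h => hψ.2.ne (h ▸ hαq)
  exact (hp ψ hψ.1 hψα).lt_or_gt.resolve_right fun h => (hq_pos ψ hψ.1 hψα h).not_gt hψ.2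

theorem HasSimpleSystems.exists_facet_point [Module.IsReflexive 𝕜 V]
    (hsimple : HasSimpleSystems Ψ) (hΨ : Ψ.Finite) {b : V} (hb : ∀ ψ ∈ Ψ, ψ b = 1)
    {α : Dual 𝕜 V} (hα : α ∈ Ψ)
    (hseg : ∀ β ∈ Ψ, ∀ γ ∈ Ψ, β ≠ α → γ ≠ α → α ∉ openSegment 𝕜 β γ) :
    ∃ p, α p = 0 ∧ ∀ ψ ∈ Ψ, ψ ≠ α → 0 < ψ p := by
  obtain ⟨p, ⟨hαp, hp⟩, hmin⟩ := exists_minimalFor_of_wellFoundedLT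
    (fun p => α p = 0 ∧ ∀ ψ ∈ Ψ, ψ ≠ α → ψ p ≠ 0) (fun p => {ψ ∈ Ψ | ψ p < 0}.ncard)
    (exists_apply_eq_zero_and_ne_zero hΨ hb hα)
  refine ⟨p, hαp, fun β hβ hβα => (hp β hβ hβα).lt_or_gt.resolve_left fun hβp => ?_⟩
  have hb_pos : ∀ ψ ∈ Ψ, 0 < ψ b := fun ψ hψ => by rw [hb ψ hψ]; exact one_pos
  obtain ⟨x, Δ, hΔ, hαΔ, hx⟩ :=
    hsimple.exists_isSimpleSystem_of_facet_point hΨ hα (hb_pos α hα) hαp hp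
  obtain ⟨γ, hγ, hγΔ⟩ := hΔ.exists_neg_mem hb_pos hβ ((hx β hβ).2 hβp)
  obtain ⟨q, hαq, hq, hlt⟩ :=
    hΔ.exists_facet_point_ssubset hΨ hb hα hγ hαΔ hγΔ hseg hαp hp hx
  have hcard := Set.ncard_lt_ncard hlt (hΨ.subset (Set.sep_subset _ _))
  exact hcard.not_ge (hmin ⟨hαq, hq⟩ hcard.le)

theorem HasSimpleSystems.mem_of_forall_notMem_openSegment [Module.IsReflexive 𝕜 V]
    (hsimple : HasSimpleSystems Ψ) (hΨ : Ψ.Finite) {b : V} (hb : ∀ ψ ∈ Ψ, ψ b = 1)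
    (hΔ : IsSimpleSystem Ψ Δ) {α : Dual 𝕜 V} (hα : α ∈ Ψ)
    (hseg : ∀ β ∈ Ψ, ∀ γ ∈ Ψ, β ≠ α → γ ≠ α → α ∉ openSegment 𝕜 β γ) : α ∈ Δ := by
  obtain ⟨p, hαp, hp⟩ := hsimple.exists_facet_point hΨ hb hα hseg
  exact hΔ.mem_of_wall hα (fun h => by simpa [h] using hb α hα) hαp hp

theorem HasSimpleSystems.exists_isSimpleSystem (hsimple : HasSimpleSystems Ψ) {b : V}
    (hb : ∀ ψ ∈ Ψ, 0 < ψ b) : ∃ Δ, IsSimpleSystem Ψ Δ := by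
  simpa only [positiveRoots_eq_self hb] using hsimple b fun ψ hψ => (hb ψ hψ).ne'

theorem span_eq_top_of_mem_hull_iff (hP : P.Finite) {x : V} (hx : ∀ φ ∈ P, 0 < φ x) {s : Set V}
    (hcone : ∀ y, y ∈ PointedCone.hull 𝕜 s ↔ ∀ φ ∈ P, 0 ≤ φ y) : Submodule.span 𝕜 s = ⊤ := by
  refine Submodule.eq_top_iff'.2 fun v => ?_
  have hmem : ∀ y, (∀ φ ∈ P, 0 < φ y) → y ∈ Submodule.span 𝕜 s := fun y hy =>
    PointedCone.hull_le_span 𝕜 s ((hcone y).2 fun φ hφ => (hy φ hφ).le)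
  obtain ⟨ε, hε, hxv⟩ := exists_pos_forall_apply_add_smul_pos hP x v
  exact ((Submodule.span 𝕜 s).smul_mem_iff hε.ne').1 <|
    ((Submodule.span 𝕜 s).add_mem_iff_right (hmem x hx)).1 (hmem _ fun φ hφ => hxv φ hφ (hx φ hφ))

theorem exists_mem_apply_basis_eq_zero {ι : Type*} [Finite ι] (e : Module.Basis ι 𝕜 V)
    (hP : P.Finite) (hP0 : ∀ φ ∈ P, φ ≠ 0)
    (hcone : ∀ y, y ∈ PointedCone.hull 𝕜 (Set.range e) ↔ ∀ φ ∈ P, 0 ≤ φ y) (i : ι) :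
    ∃ φ ∈ P, 0 < φ (e i) ∧ ∀ j, j ≠ i → φ (e j) = 0 := by
  classical
  have := Fintype.ofFinite ι
  have he_nonneg : ∀ φ ∈ P, ∀ j, 0 ≤ φ (e j) := fun φ hφ j =>
    (hcone (e j)).1 (PointedCone.subset_hull (Set.mem_range_self j)) φ hφ
  obtain ⟨φ, hφ, hφ_nonpos⟩ : ∃ φ ∈ P, φ (∑ j ∈ Finset.univ.erase i, e j) ≤ 0 := by
    by_contra! hpos
    obtain ⟨ε, hε, h⟩ :=
      exists_pos_forall_apply_add_smul_pos hP (∑ j ∈ Finset.univ.erase i, e j) (-e i)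
    have hmem := (hcone _).2 fun φ hφ => (h φ hφ (hpos φ hφ)).le
    have hcoord := apply_nonneg_of_mem_hull (f := e.coord i)
      (Set.forall_mem_range.2 fun j => by
        rw [e.coord_apply, e.repr_self_apply]; split_ifs <;> simp) hmem
    rw [map_add, map_sum, Finset.sum_eq_zero fun j hj => by simp [(Finset.ne_of_mem_erase hj)]]
      at hcoord
    simp at hcoord
    linarith
  rw [map_sum] at hφ_nonpos
  have hzero : ∀ j, j ≠ i → φ (e j) = 0 := fun j hj =>
    (Finset.sum_eq_zero_iff_of_nonneg fun k _ => he_nonneg φ hφ k).1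
      (hφ_nonpos.antisymm (Finset.sum_nonneg fun k _ => he_nonneg φ hφ k)) j (by simp [hj])
  refine ⟨φ, hφ, (he_nonneg φ hφ i).lt_of_ne fun h => hP0 φ hφ (e.ext fun j => ?_), hzero⟩
  rcases eq_or_ne j i with rfl | hj
  · exact h.symm
  · exact hzero j hj

theorem isSimpleSystem_range_of_apply_basis {ι : Type*} [Finite ι] (e : Module.Basis ι 𝕜 V)
    (hP : ∀ φ ∈ P, ∀ i, 0 ≤ φ (e i)) {δ : ι → Dual 𝕜 V} (hδ : ∀ i, δ i ∈ P)
    (hpos : ∀ i, 0 < δ i (e i)) (hzero : ∀ i j, j ≠ i → δ i (e j) = 0) :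
    IsSimpleSystem P (Set.range δ) := by
  classical
  have := Fintype.ofFinite ι
  have hsum : ∀ (c : ι → 𝕜) j, (∑ i, c i • δ i) (e j) = c j * δ j (e j) := fun c j => by
    rw [LinearMap.sum_apply, Finset.sum_eq_single j] <;> simp +contextual [hzero, Ne.symm]
  refine ⟨Set.range_subset_iff.2 hδ, ?_, fun φ hφ => ?_⟩
  · refine LinearIndependent.linearIndepOn_id (Fintype.linearIndependent_iff.2 fun c hc j => ?_)
    have h := hsum c j
    rw [hc, LinearMap.zero_apply] at h
    exact (mul_eq_zero.1 h.symm).resolve_right (hpos j).ne'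
  · have hφ_sum : φ = ∑ i, (φ (e i) / δ i (e i)) • δ i :=
      e.ext fun j => by rw [hsum, div_mul_cancel₀ _ (hpos j).ne']
    rw [hφ_sum]
    exact sum_mem fun i _ => PointedCone.smul_mem _ (div_nonneg (hP φ hφ i) (hpos i).le)
      (PointedCone.subset_hull (Set.mem_range_self i))

theorem exists_isSimpleSystem_of_mem_hull_iff [FiniteDimensional 𝕜 V] (hP : P.Finite) {x : V}
    (hx : ∀ φ ∈ P, 0 < φ x) {s : Set V} (hs : LinearIndepOn 𝕜 id s)
    (hcone : ∀ y, y ∈ PointedCone.hull 𝕜 s ↔ ∀ φ ∈ P, 0 ≤ φ y) : ∃ Δ, IsSimpleSystem P Δ := by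
  let e : Module.Basis s 𝕜 V := .mk hs <| by
    simpa using (span_eq_top_of_mem_hull_iff hP hx hcone).ge
  have he : Set.range e = s := by simp [e]
  have : Finite s := Module.Finite.finite_basis e
  rw [← he] at hcone
  choose δ hδ hpos hzero using
    exists_mem_apply_basis_eq_zero e hP (fun φ hφ h => by simpa [h] using hx φ hφ) hcone
  exact ⟨_, isSimpleSystem_range_of_apply_basis e (fun φ hφ i =>
    (hcone _).1 (PointedCone.subset_hull (Set.mem_range_self i)) φ hφ) hδ hpos hzero⟩

theorem IsSimpleSystem.mem_hull_of_mem_openSegment [Module.IsReflexive 𝕜 V]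
    (hΔ : IsSimpleSystem P Δ) {Δ' : Set (Dual 𝕜 V)} (hΔ' : Δ' ⊆ Δ) {φ χ ψ : Dual 𝕜 V} (hφ : φ ∈ P)
    (hχ : χ ∈ P) (hψ : ψ ∈ Submodule.span 𝕜 Δ') (hseg : ψ ∈ openSegment 𝕜 φ χ) :
    φ ∈ PointedCone.hull 𝕜 Δ' := by
  obtain ⟨f, hf, hf₀, hface⟩ := hΔ.exists_face_point hΔ'
  have hψf : ψ f = 0 :=
    (Submodule.span_le (p := LinearMap.ker (Dual.eval 𝕜 V f))).2 hf₀ hψ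
  obtain ⟨s, t, hs, ht, -, rfl⟩ := hseg
  have hsum : s * φ f + t * χ f = 0 := hψf
  have hφf := mul_nonneg hs.le (hf φ hφ)
  have hχf := mul_nonneg ht.le (hf χ hχ)
  exact hface φ hφ ((mul_eq_zero_iff_left hs.ne').1 (by linarith))

end SimpleSystems

/-! ### Cells -/

section Cells

variable {𝕜 V : Type*} [Field 𝕜] [LinearOrder 𝕜] [AddCommGroup V] [Module 𝕜 V]

/-- The points of the subspace `W` at which no functional of `Ψ` vanishes. -/
def regularPoints (W : Submodule 𝕜 V) (Ψ : Set (Dual 𝕜 V)) : Set V :=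
  {y | y ∈ W ∧ ∀ ψ ∈ Ψ, ψ y ≠ 0}

/-- The closed cell of `x` in the central arrangement cut out on the subspace `W` by the
hyperplanes `ker ψ`, `ψ ∈ Ψ`, for a regular point `x`. -/
def cell (W : Submodule 𝕜 V) (Ψ : Set (Dual 𝕜 V)) (x : V) : Set V :=
  {y | y ∈ W ∧ ∀ φ ∈ positiveRoots Ψ x, 0 ≤ φ y}

variable {W : Submodule 𝕜 V} {Ψ : Set (Dual 𝕜 V)} {x y : V}

theorem self_mem_cell (hx : x ∈ W) : x ∈ cell W Ψ x :=
  ⟨hx, fun _ hφ => hφ.2.le⟩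

theorem positiveRoots_apply_pos (hy : y ∈ cell W Ψ x ∩ regularPoints W Ψ) :
    ∀ φ ∈ positiveRoots Ψ x, 0 < φ y := fun φ hφ =>
  (hy.1.2 φ hφ).lt_of_ne' <|
    hφ.1.elim (hy.2.2 φ) fun h h0 => hy.2.2 _ h (by rw [LinearMap.neg_apply, h0, neg_zero])

variable [IsStrictOrderedRing 𝕜]

theorem exists_mem_positiveRoots (hx : x ∈ regularPoints W Ψ) {ψ : Dual 𝕜 V} (hψ : ψ ∈ Ψ) :
    ψ ∈ positiveRoots Ψ x ∨ -ψ ∈ positiveRoots Ψ x :=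
  (hx.2 ψ hψ).lt_or_gt.symm.imp (fun h => ⟨.inl hψ, h⟩)
    fun h => ⟨.inr ((neg_neg ψ).symm ▸ hψ), neg_pos.2 h⟩

theorem mem_regularPoints_of_apply_pos (hx : x ∈ regularPoints W Ψ) (hy : y ∈ W)
    (h : ∀ φ ∈ positiveRoots Ψ x, 0 < φ y) : y ∈ regularPoints W Ψ :=
  ⟨hy, fun ψ hψ => (exists_mem_positiveRoots hx hψ).elim (fun hψ => (h ψ hψ).ne')
    fun hψ => (neg_pos.1 (h (-ψ) hψ)).ne⟩

theorem cell_eq_of_mem (hx : x ∈ regularPoints W Ψ) (hy : y ∈ cell W Ψ x ∩ regularPoints W Ψ) :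
    cell W Ψ y = cell W Ψ x := by
  have hpos := positiveRoots_apply_pos hy
  suffices positiveRoots Ψ y = positiveRoots Ψ x by rw [cell, cell, this]
  ext φ
  refine ⟨fun ⟨hφ, hφy⟩ => ⟨hφ, ?_⟩, fun hφ => ⟨hφ.1, hpos φ hφ⟩⟩
  rcases hφ with hφ | hφ
  · exact ((exists_mem_positiveRoots hx hφ).resolve_right fun h =>
      hφy.not_gt (neg_pos.1 (hpos _ h))).2
  · have h := (exists_mem_positiveRoots hx hφ).resolve_left fun h =>
      hφy.not_gt (neg_pos.1 (hpos _ h))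
    rw [neg_neg] at h
    exact h.2

theorem openSegment_subset_cell (hx : x ∈ regularPoints W Ψ) (hy : y ∈ cell W Ψ x) :
    openSegment 𝕜 x y ⊆ cell W Ψ x ∩ regularPoints W Ψ := by
  intro z hz
  have hzW : z ∈ W := W.convex.openSegment_subset hx.1 hy.1 hz
  have hpos : ∀ φ ∈ positiveRoots Ψ x, 0 < φ z := by
    obtain ⟨a, c, ha, hc, -, rfl⟩ := hz
    intro φ hφ
    rw [map_add, map_smul, map_smul]
    exact add_pos_of_pos_of_nonneg (mul_pos ha hφ.2) (mul_nonneg hc.le (hy.2 φ hφ))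
  exact ⟨⟨hzW, fun φ hφ => (hpos φ hφ).le⟩, mem_regularPoints_of_apply_pos hx hzW hpos⟩

theorem starConvex_cell_inter_regularPoints (hx : x ∈ regularPoints W Ψ) :
    StarConvex 𝕜 x (cell W Ψ x ∩ regularPoints W Ψ) :=
  have hxx : x ∈ cell W Ψ x ∩ regularPoints W Ψ := ⟨self_mem_cell hx.1, hx⟩
  (starConvex_iff_openSegment_subset hxx).2 fun _ hy => openSegment_subset_cell hx hy.1

theorem convex_cell : Convex 𝕜 (cell W Ψ x) := by
  have : cell W Ψ x = (W : Set V) ∩ ⋂ φ ∈ positiveRoots Ψ x, {y | 0 ≤ φ y} := by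
    ext; simp [cell]
  rw [this]
  exact W.convex.inter (convex_iInter₂ fun φ _ => convex_halfSpace_ge φ.isLinear 0)

theorem exists_openSegment_apply_eq_zero {φ : Dual 𝕜 V} (hx : 0 < φ x) (hy : φ y < 0) :
    ∃ z ∈ openSegment 𝕜 x y, φ z = 0 := by
  have hd : 0 < φ x - φ y := by linarith
  refine ⟨(-φ y / (φ x - φ y)) • x + (φ x / (φ x - φ y)) • y,
    ⟨_, _, div_pos (neg_pos.2 hy) hd, div_pos hx hd, by field_simp; ring, rfl⟩, ?_⟩
  simp only [map_add, map_smul, smul_eq_mul]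
  field_simp
  ring

theorem direction_affineSpan_of_cell_subset (hΨ : Ψ.Finite) (hx : x ∈ W) {S : Set V}
    (hcell : cell W Ψ x ⊆ S) (hS : S ⊆ W) : (affineSpan 𝕜 S).direction = W := by
  refine le_antisymm ?_ fun w hw => ?_
  · simpa using AffineSubspace.direction_le (affineSpan_le (Q := W.toAffineSubspace).2 hS)
  · obtain ⟨ε, hε, hpos⟩ :=
      exists_pos_forall_apply_add_smul_pos (finite_positiveRoots hΨ x) x w
    have hmem : x + ε • w ∈ S := hcell
      ⟨W.add_mem hx (W.smul_mem ε hw), fun φ hφ => (hpos φ hφ hφ.2).le⟩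
    have hsub := AffineSubspace.vsub_mem_direction (subset_affineSpan 𝕜 S hmem)
      (subset_affineSpan 𝕜 S (hcell (self_mem_cell hx)))
    rwa [vsub_eq_sub, add_sub_cancel_left, Submodule.smul_mem_iff _ hε.ne'] at hsub

end Cells

section TopologyOfCells

theorem exists_pos_add_smul_sub_mem_of_mem_intrinsicInterior {E : Type*} [AddCommGroup E]
    [Module ℝ E] [TopologicalSpace E] [IsTopologicalAddGroup E] [ContinuousSMul ℝ E] {S : Set E}
    {y z : E} (hy : y ∈ intrinsicInterior ℝ S) (hz : z ∈ affineSpan ℝ S) :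
    ∃ t > (0 : ℝ), y + t • (y - z) ∈ S := by
  obtain ⟨⟨y, hyS⟩, hyint, rfl⟩ := mem_intrinsicInterior.1 hy
  let g : ℝ → affineSpan ℝ S := fun t => ⟨y + t • (y - z), by
    rw [add_comm]; exact AffineSubspace.smul_vsub_vadd_mem _ t hyS hz hyS⟩
  have hg : Continuous g := by fun_prop
  have hg0 : g 0 = ⟨y, hyS⟩ := by simp [g]
  have hev : ∀ᶠ t in nhds 0, g t ∈ ((↑) ⁻¹' S : Set (affineSpan ℝ S)) :=
    hg.continuousAt.eventually_mem (by rw [hg0]; exact mem_interior_iff_mem_nhds.1 hyint)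
  obtain ⟨t, htS, ht⟩ := ((hev.filter_mono nhdsWithin_le_nhds).and
    (self_mem_nhdsWithin (s := Set.Ioi 0))).exists
  exact ⟨t, ht, htS⟩

variable {E : Type*} [AddCommGroup E] [Module ℝ E] [TopologicalSpace E] [IsTopologicalAddGroup E]
  [ContinuousSMul ℝ E] [T2Space E] [FiniteDimensional ℝ E] {W : Submodule ℝ E}
  {Ψ : Set (Dual ℝ E)} {x : E}

theorem isClosed_cell : IsClosed (cell W Ψ x) := by
  have : cell W Ψ x = (W : Set E) ∩ ⋂ φ ∈ positiveRoots Ψ x, {y | 0 ≤ φ y} := by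
    ext; simp [cell]
  rw [this]
  exact W.closed_of_finiteDimensional.inter (isClosed_biInter fun φ _ =>
    isClosed_le continuous_const φ.continuous_of_finiteDimensional)

theorem connectedComponentIn_regularPoints (hx : x ∈ regularPoints W Ψ) :
    connectedComponentIn (regularPoints W Ψ) x = cell W Ψ x ∩ regularPoints W Ψ := by
  refine Set.Subset.antisymm (fun y hy => ?_) <|
    ((starConvex_cell_inter_regularPoints hx).isPathConnected
      ⟨self_mem_cell hx.1, hx⟩).isConnected.isPreconnected.subset_connectedComponentIn
      ⟨self_mem_cell hx.1, hx⟩ Set.inter_subset_right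
  have hyreg := connectedComponentIn_subset _ _ hy
  refine ⟨⟨hyreg.1, fun φ hφ => ?_⟩, hyreg⟩
  by_contra! hφy
  obtain ⟨z, hz, hz0⟩ := isPreconnected_connectedComponentIn.intermediate_value hy
    (mem_connectedComponentIn hx) φ.continuous_of_finiteDimensional.continuousOn ⟨hφy.le, hφ.2.le⟩
  have hzreg := (connectedComponentIn_subset _ _ hz).2
  exact hφ.1.elim (fun h => hzreg φ h hz0) fun h => hzreg _ h (by simp [hz0])

theorem closure_connectedComponentIn_regularPoints (hx : x ∈ regularPoints W Ψ) :
    closure (connectedComponentIn (regularPoints W Ψ) x) = cell W Ψ x := by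
  rw [connectedComponentIn_regularPoints hx]
  exact (closure_minimal Set.inter_subset_left isClosed_cell).antisymm fun y hy =>
    closure_mono (openSegment_subset_cell hx hy)
      (segment_subset_closure_openSegment (right_mem_segment ℝ x y))

theorem intrinsicInterior_cell (hΨ : Ψ.Finite) (hx : x ∈ regularPoints W Ψ) :
    intrinsicInterior ℝ (cell W Ψ x) = cell W Ψ x ∩ regularPoints W Ψ := by
  apply Set.Subset.antisymm
  · intro y hy
    have hycell := intrinsicInterior_subset hy
    obtain ⟨t, ht, hyt⟩ := exists_pos_add_smul_sub_mem_of_mem_intrinsicInterior hy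
      (subset_affineSpan ℝ _ (self_mem_cell hx.1))
    refine ⟨hycell, mem_regularPoints_of_apply_pos hx hycell.1 fun φ hφ => ?_⟩
    have hφyt : 0 ≤ φ y + t * (φ y - φ x) := by simpa using hyt.2 φ hφ
    nlinarith [mul_pos ht hφ.2]
  · intro y hy
    have hspan : affineSpan ℝ (cell W Ψ x) ≤ W.toAffineSubspace := affineSpan_le.2 fun z hz => hz.1
    let U : Set (affineSpan ℝ (cell W Ψ x)) := ⋂ φ ∈ positiveRoots Ψ x, {z | 0 < φ z}
    have hU : IsOpen U := (finite_positiveRoots hΨ x).isOpen_biInter fun φ _ =>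
      isOpen_lt continuous_const
        (φ.continuous_of_finiteDimensional.comp continuous_subtype_val)
    refine mem_intrinsicInterior.2 ⟨⟨y, subset_affineSpan ℝ _ hy.1⟩, mem_interior.2
      ⟨U, fun z hz => ⟨hspan z.2, fun φ hφ => ?_⟩, hU, ?_⟩, rfl⟩
    · exact (Set.mem_iInter₂.1 hz φ hφ : 0 < φ z).le
    · exact Set.mem_iInter₂.2 (positiveRoots_apply_pos hy)

end TopologyOfCells

theorem hasCodim_of_cell_subset {d k : ℕ} {W : Submodule ℝ (EuclideanSpace ℝ (Fin d))}
    (hW : Module.finrank ℝ W + k = d) {Ψ : Set (Dual ℝ (EuclideanSpace ℝ (Fin d)))}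
    (hΨ : Ψ.Finite) {x : EuclideanSpace ℝ (Fin d)} (hx : x ∈ W)
    {S : Set (EuclideanSpace ℝ (Fin d))} (hcell : cell W Ψ x ⊆ S) (hS : S ⊆ W) :
    HasCodim S k :=
  ⟨⟨x, hcell (self_mem_cell hx)⟩, by rwa [direction_affineSpan_of_cell_subset hΨ hx hcell hS]⟩

theorem HasCodim.le_of_subset {d k : ℕ} {S : Set (EuclideanSpace ℝ (Fin d))} (hS : HasCodim S k)
    {W K : Submodule ℝ (EuclideanSpace ℝ (Fin d))} (hW : Module.finrank ℝ W + k = d)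
    (hSW : S ⊆ W) (hSK : S ⊆ K) : W ≤ K := by
  have hdir : (affineSpan ℝ S).direction ≤ W ⊓ K := by
    simpa using AffineSubspace.direction_le
      (affineSpan_le (Q := (W ⊓ K).toAffineSubspace).2 (Set.subset_inter hSW hSK))
  refine inf_eq_left.1 (Submodule.eq_of_le_of_finrank_le inf_le_left ?_)
  have := Submodule.finrank_mono hdir
  have := hS.2
  omega

/-! ### Hyperplane arrangements -/

section Arrangements

variable {d : ℕ}

theorem IsHyperplane.eq_of_le {H K : Submodule ℝ (EuclideanSpace ℝ (Fin d))}
    (hH : IsHyperplane H) (hK : IsHyperplane K) (h : H ≤ K) : H = K :=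
  Submodule.eq_of_le_of_finrank_eq h (Nat.succ_injective (hH.trans hK.symm))

theorem IsHyperplane.exists_ker_eq_and_apply_eq_one
    {H : Submodule ℝ (EuclideanSpace ℝ (Fin d))} (hH : IsHyperplane H)
    {b : EuclideanSpace ℝ (Fin d)} (hb : b ∉ H) :
    ∃ f : Dual ℝ (EuclideanSpace ℝ (Fin d)), LinearMap.ker f = H ∧ f b = 1 := by
  obtain ⟨f, hfb, hle⟩ := Submodule.exists_le_ker_of_notMem hb
  have hker : IsHyperplane (LinearMap.ker f) := by
    have hf : f ≠ 0 := fun h => hfb (by simp [h])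
    simpa [IsHyperplane] using Module.Dual.finrank_ker_add_one_of_ne_zero hf
  exact ⟨(f b)⁻¹ • f, by rw [LinearMap.ker_smul _ _ (inv_ne_zero hfb), hH.eq_of_le hker hle],
    by simp [hfb]⟩

/-- A choice of normal functionals `ν H` of the hyperplanes of `A`, nonnegative on `B` and
normalised to be `1` at the point `b` of `B`. The normalisation turns positive proportionality into
equality, so that rank-two subarrangements become lines in the dual space. -/
structure IsNormalFamily (A : Set (Submodule ℝ (EuclideanSpace ℝ (Fin d))))
    (B : Set (EuclideanSpace ℝ (Fin d))) (b : EuclideanSpace ℝ (Fin d))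
    (ν : Submodule ℝ (EuclideanSpace ℝ (Fin d)) → Dual ℝ (EuclideanSpace ℝ (Fin d))) : Prop where
  mem_base : b ∈ B
  ker_eq : ∀ H ∈ A, LinearMap.ker (ν H) = H
  apply_base : ∀ H ∈ A, ν H b = 1
  apply_nonneg : ∀ H ∈ A, ∀ y ∈ B, 0 ≤ ν H y

variable {A A' : Set (Submodule ℝ (EuclideanSpace ℝ (Fin d)))}
  {B : Set (EuclideanSpace ℝ (Fin d))} {b : EuclideanSpace ℝ (Fin d)}
  {ν : Submodule ℝ (EuclideanSpace ℝ (Fin d)) → Dual ℝ (EuclideanSpace ℝ (Fin d))}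
  {H H₁ H₂ K L : Submodule ℝ (EuclideanSpace ℝ (Fin d))}

theorem IsArrangement.mono (hA : IsArrangement A) (h : A' ⊆ A) : IsArrangement A' :=
  ⟨hA.finite.subset h, fun H hH => hA.isHyperplane H (h hH)⟩

theorem IsNormalFamily.mono (hν : IsNormalFamily A B b ν) (h : A' ⊆ A) :
    IsNormalFamily A' B b ν :=
  ⟨hν.mem_base, fun H hH => hν.ker_eq H (h hH), fun H hH => hν.apply_base H (h hH),
    fun H hH => hν.apply_nonneg H (h hH)⟩

theorem IsNormalFamily.apply_eq_zero_iff (hν : IsNormalFamily A B b ν) (hH : H ∈ A)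
    {y : EuclideanSpace ℝ (Fin d)} : ν H y = 0 ↔ y ∈ H := by
  rw [← LinearMap.mem_ker, hν.ker_eq H hH]

theorem IsNormalFamily.injOn (hν : IsNormalFamily A B b ν) : Set.InjOn ν A :=
  fun H hH K hK h => by rw [← hν.ker_eq H hH, h, hν.ker_eq K hK]

theorem IsNormalFamily.image_apply_base (hν : IsNormalFamily A B b ν) :
    ∀ ψ ∈ ν '' A, ψ b = 1 :=
  Set.forall_mem_image.2 hν.apply_base

theorem IsNormalFamily.positiveRoots_base (hν : IsNormalFamily A B b ν) :
    positiveRoots (ν '' A) b = ν '' A :=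
  positiveRoots_eq_self fun ψ hψ => by rw [hν.image_apply_base ψ hψ]; exact one_pos

theorem sep_forall_notMem_eq_regularPoints (hker : ∀ K ∈ A, LinearMap.ker (ν K) = K) :
    {x | x ∈ H ∧ ∀ K ∈ A, x ∉ K} = regularPoints H (ν '' A) := by
  ext x
  refine and_congr_right fun _ => ?_
  rw [Set.forall_mem_image]
  exact forall₂_congr fun K hK => not_congr (by rw [← LinearMap.mem_ker, hker K hK])

theorem complement_eq_regularPoints (hker : ∀ K ∈ A, LinearMap.ker (ν K) = K) :
    complement A = regularPoints ⊤ (ν '' A) := by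
  rw [← sep_forall_notMem_eq_regularPoints hker]
  simp [complement]

theorem closure_connectedComponentIn_complement (hker : ∀ K ∈ A, LinearMap.ker (ν K) = K)
    {x : EuclideanSpace ℝ (Fin d)} (hx : x ∈ complement A) :
    closure (connectedComponentIn (complement A) x) = cell ⊤ (ν '' A) x := by
  rw [complement_eq_regularPoints hker] at hx ⊢
  exact closure_connectedComponentIn_regularPoints hx

theorem IsRegion.exists_isNormalFamily (hB : IsRegion A B) (hA : IsArrangement A) :
    ∃ b ν, IsNormalFamily A B b ν := by
  obtain ⟨b, hb, rfl⟩ := hB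
  choose! ν hker hone using
    fun H hH => (hA.isHyperplane H hH).exists_ker_eq_and_apply_eq_one (hb H hH)
  rw [closure_connectedComponentIn_complement hker hb]
  exact ⟨b, ν, self_mem_cell Submodule.mem_top, hker, hone, fun H hH y hy =>
    hy.2 _ ⟨.inl ⟨H, hH, rfl⟩, by rw [hone H hH]; exact one_pos⟩⟩

theorem IsNormalFamily.base_mem_complement (hν : IsNormalFamily A B b ν) : b ∈ complement A :=
  fun H hH hb => one_ne_zero <| (hν.apply_base H hH).symm.trans ((hν.apply_eq_zero_iff hH).2 hb)

theorem IsNormalFamily.mem_cell_base_iff (hν : IsNormalFamily A B b ν)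
    {y : EuclideanSpace ℝ (Fin d)} : y ∈ cell ⊤ (ν '' A) b ↔ ∀ H ∈ A, 0 ≤ ν H y := by
  simp [cell, hν.positiveRoots_base]

theorem IsSimplicial.hasSimpleSystems (hsimp : IsSimplicial A) (hA : IsArrangement A)
    (hker : ∀ K ∈ A, LinearMap.ker (ν K) = K) : HasSimpleSystems (ν '' A) := by
  intro x hx
  have hxA : x ∈ complement A := by
    rw [complement_eq_regularPoints hker]; exact ⟨Submodule.mem_top, hx⟩
  obtain ⟨s, hs, hcone⟩ := hsimp _ ⟨x, hxA, rfl⟩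
  rw [closure_connectedComponentIn_complement hker hxA] at hcone
  refine exists_isSimpleSystem_of_mem_hull_iff (finite_positiveRoots (hA.finite.image ν) x)
    (fun φ hφ => hφ.2) hs fun y => ?_
  rw [← SetLike.mem_coe, ← hcone]
  exact and_iff_right Submodule.mem_top

theorem IsNormalFamily.eq_cell_of_isRegion (hν : IsNormalFamily A B b ν)
    {B' : Set (EuclideanSpace ℝ (Fin d))} (hB' : IsRegion A B') (h : b ∈ B') :
    B' = cell ⊤ (ν '' A) b := by
  obtain ⟨x, hx, rfl⟩ := hB'
  have hb := hν.base_mem_complement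
  rw [closure_connectedComponentIn_complement hν.ker_eq hx] at h ⊢
  rw [complement_eq_regularPoints hν.ker_eq] at hx hb
  exact (cell_eq_of_mem hx ⟨h, hb⟩).symm

theorem IsNormalFamily.exists_forall_lt_of_hasCodim (hν : IsNormalFamily A B b ν)
    (hA : IsArrangement A) (hH : H ∈ A)
    (hcodim : HasCodim ((H : Set (EuclideanSpace ℝ (Fin d))) ∩ cell ⊤ (ν '' A) b) 1) :
    ∃ p, ∀ K ∈ A, K ≠ H → ν H p < ν K p := by
  obtain ⟨p, ⟨hpH, hpcell⟩, hp⟩ := exists_mem_forall_notMem_of_convex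
    (H.convex.inter convex_cell) hcodim.1 (hA.finite.sdiff (t := {H})) fun K hK hle =>
      hK.2 ((hA.isHyperplane H hH).eq_of_le (hA.isHyperplane K hK.1) <|
        hcodim.le_of_subset (hA.isHyperplane H hH) Set.inter_subset_left hle).symm
  refine ⟨p, fun K hK hKH => ?_⟩
  rw [(hν.apply_eq_zero_iff hH).2 hpH]
  exact (hν.mem_cell_base_iff.1 hpcell K hK).lt_of_ne'
    fun h => hp K ⟨hK, hKH⟩ ((hν.apply_eq_zero_iff hK).1 h)

theorem IsNormalFamily.hasCodim_of_forall_lt (hν : IsNormalFamily A B b ν)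
    (hA : IsArrangement A) (hH : H ∈ A) {p : EuclideanSpace ℝ (Fin d)}
    (hp : ∀ K ∈ A, K ≠ H → ν H p < ν K p) :
    HasCodim ((H : Set (EuclideanSpace ℝ (Fin d))) ∩ cell ⊤ (ν '' A) b) 1 := by
  have hqH : p - ν H p • b ∈ H :=
    (hν.apply_eq_zero_iff hH).1 (by simp [hν.apply_base H hH])
  refine hasCodim_of_cell_subset (hA.isHyperplane H hH)
    ((hA.finite.sdiff (t := {H})).image ν) hqH (fun y hy => ⟨hy.1, ?_⟩) Set.inter_subset_left
  refine hν.mem_cell_base_iff.2 fun K hK => ?_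
  rcases eq_or_ne K H with rfl | hKH
  · exact ((hν.apply_eq_zero_iff hK).2 hy.1).ge
  · refine hy.2 _ ⟨.inl ⟨K, ⟨hK, hKH⟩, rfl⟩, ?_⟩
    simpa [hν.apply_base K hK] using hp K hK hKH

/- By the normalisation at `b`, this says that `ν H` is an exposed point of the convex hull of the
normals. -/
theorem IsNormalFamily.isBasic_iff (hν : IsNormalFamily A B b ν) (hA : IsArrangement A) :
    IsBasic A B H ↔ H ∈ A ∧ ∃ p, ∀ K ∈ A, K ≠ H → ν H p < ν K p := by
  refine and_congr_right fun hH => ⟨?_, ?_⟩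
  · rintro ⟨B', hB', hBB', hcodim⟩
    rw [hν.eq_cell_of_isRegion hB' (hBB' hν.mem_base)] at hcodim
    exact hν.exists_forall_lt_of_hasCodim hA hH hcodim
  · rintro ⟨p, hp⟩
    exact ⟨_, ⟨b, hν.base_mem_complement,
      (closure_connectedComponentIn_complement hν.ker_eq hν.base_mem_complement).symm⟩,
      fun y hy => hν.mem_cell_base_iff.2 fun K hK => hν.apply_nonneg K hK y hy,
      hν.hasCodim_of_forall_lt hA hH hp⟩

theorem IsBasic.notMem_openSegment (hH : IsBasic A B H) (hA : IsArrangement A)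
    (hν : IsNormalFamily A B b ν) (hK : K ∈ A) (hL : L ∈ A) (hKH : K ≠ H) (hLH : L ≠ H) :
    ν H ∉ openSegment ℝ (ν K) (ν L) := by
  rintro ⟨s, t, hs, ht, hst, h⟩
  obtain ⟨-, p, hp⟩ := (hν.isBasic_iff hA).1 hH
  have hHp : s * ν K p + t * ν L p = ν H p := by simpa using LinearMap.congr_fun h p
  have hs_eq : s = 1 - t := by linarith
  have := mul_pos hs (sub_pos.2 (hp K hK hKH))
  have := mul_pos ht (sub_pos.2 (hp L hL hLH))
  subst hs_eq
  nlinarith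

theorem rankTwo_subset : rankTwo A K L ⊆ A := Set.sep_subset _ _

theorem left_mem_rankTwo (hK : K ∈ A) : K ∈ rankTwo A K L := ⟨hK, inf_le_left⟩

theorem right_mem_rankTwo (hL : L ∈ A) : L ∈ rankTwo A K L := ⟨hL, inf_le_right⟩

theorem rankTwo_eq_of_mem (hA : IsArrangement A) (h₁ : H₁ ∈ A) (h₂ : H₂ ∈ A) (hne : H₁ ≠ H₂)
    (hK : K ∈ rankTwo A H₁ H₂) (hL : L ∈ rankTwo A H₁ H₂) (hKL : K ≠ L) :
    rankTwo A K L = rankTwo A H₁ H₂ :=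
  (eq_rankTwo hA (isRankTwoSubarrangement_rankTwo hA h₁ h₂ hne) hK hL hKL).symm

theorem IsNormalFamily.exists_eq_lineMap (hν : IsNormalFamily A B b ν) (hK : K ∈ A) (hL : L ∈ A)
    (hH : H ∈ rankTwo A K L) : ∃ t : ℝ, ν H = AffineMap.lineMap (ν K) (ν L) t := by
  refine exists_eq_lineMap_of_ker_inf_ker_le (hν.apply_base K hK) (hν.apply_base L hL)
    (hν.apply_base H hH.1) ?_
  rw [hν.ker_eq K hK, hν.ker_eq L hL, hν.ker_eq H hH.1]
  exact hH.2

theorem IsNormalFamily.exists_injOn_apply (hν : IsNormalFamily A B b ν) (hA : IsArrangement A)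
    (h₁ : H₁ ∈ A) (h₂ : H₂ ∈ A) (hne : H₁ ≠ H₂) :
    ∃ v, Set.InjOn (fun H => ν H v) (rankTwo A H₁ H₂) := by
  obtain ⟨v, hv⟩ := DFunLike.ne_iff.1 (hν.injOn.ne h₁ h₂ hne)
  refine ⟨v, fun K hK L hL hKL => by_contra fun hne' => hv ?_⟩
  have hconst : ∀ H ∈ rankTwo A H₁ H₂, ν H v = ν K v := by
    intro H hH
    rw [← rankTwo_eq_of_mem hA h₁ h₂ hne hK hL hne'] at hH
    obtain ⟨t, ht⟩ := hν.exists_eq_lineMap hK.1 hL.1 hH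
    have hKL : ν K v = ν L v := hKL
    simp [ht, AffineMap.lineMap_apply_module', hKL]
  exact (hconst H₁ (left_mem_rankTwo h₁)).trans (hconst H₂ (right_mem_rankTwo h₂)).symm

theorem IsNormalFamily.isBasic_of_forall_le (hν : IsNormalFamily A B b ν) (hA : IsArrangement A)
    {v : EuclideanSpace ℝ (Fin d)} (hv : Set.InjOn (fun H => ν H v) A) (hH : H ∈ A)
    (hmin : ∀ K ∈ A, ν H v ≤ ν K v) : IsBasic A B H :=
  (hν.isBasic_iff hA).2 ⟨hH, v, fun K hK hne => (hmin K hK).lt_of_ne' (hv.ne hK hH hne)⟩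

theorem IsNormalFamily.exists_isBasic_pair (hν : IsNormalFamily A B b ν) (hA : IsArrangement A)
    (h₁ : H₁ ∈ A) (h₂ : H₂ ∈ A) (hne : H₁ ≠ H₂) :
    ∃ K L, IsBasic (rankTwo A H₁ H₂) B K ∧ IsBasic (rankTwo A H₁ H₂) B L ∧
      ∀ H ∈ rankTwo A H₁ H₂, ν H ∈ segment ℝ (ν K) (ν L) := by
  have hA' := hA.mono (rankTwo_subset (K := H₁) (L := H₂))
  have hν' := hν.mono (rankTwo_subset (K := H₁) (L := H₂))
  have hnonempty : (rankTwo A H₁ H₂).Nonempty := ⟨H₁, left_mem_rankTwo h₁⟩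
  obtain ⟨v, hv⟩ := hν.exists_injOn_apply hA h₁ h₂ hne
  obtain ⟨K, hK, hmin⟩ := Set.exists_min_image _ (fun H => ν H v) hA'.finite hnonempty
  obtain ⟨L, hL, hmax⟩ := Set.exists_max_image _ (fun H => ν H v) hA'.finite hnonempty
  have hKL : ν K v < ν L v := by
    refine lt_of_not_ge fun hle => hv.ne (left_mem_rankTwo h₁) (right_mem_rankTwo h₂) hne ?_
    have hconst : ∀ H ∈ rankTwo A H₁ H₂, ν H v = ν K v := fun H hH =>
      ((hmax H hH).trans hle).antisymm (hmin H hH)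
    exact (hconst _ (left_mem_rankTwo h₁)).trans (hconst _ (right_mem_rankTwo h₂)).symm
  have hL_basic : IsBasic (rankTwo A H₁ H₂) B L :=
    hν'.isBasic_of_forall_le hA' (v := -v) (by simpa [Set.InjOn] using hv) hL (by simpa using hmax)
  refine ⟨K, L, hν'.isBasic_of_forall_le hA' hv hK hmin, hL_basic, fun H hH => ?_⟩
  have hne' : K ≠ L := fun h => hKL.ne (by rw [h])
  have hHKL : H ∈ rankTwo A K L := rankTwo_eq_of_mem hA h₁ h₂ hne hK hL hne' ▸ hH
  obtain ⟨t, ht⟩ := hν.exists_eq_lineMap hK.1 hL.1 hHKL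
  have htv : ν H v = ν K v + t * (ν L v - ν K v) := by
    simp [ht, AffineMap.lineMap_apply_module']; ring
  rw [segment_eq_image_lineMap]
  exact ⟨t, ⟨by nlinarith [hmin H hH], by nlinarith [hmax H hH]⟩, ht.symm⟩

theorem Cuts.exists_mem_openSegment (hKH : Cuts A B K H) (hA : IsArrangement A)
    (hν : IsNormalFamily A B b ν) :
    ∃ L, L ≠ K ∧ IsBasic (rankTwo A K H) B L ∧ ν H ∈ openSegment ℝ (ν K) (ν L) := by
  obtain ⟨hK, hH, hne, hKbasic, hHbasic⟩ := hKH
  have hA' := hA.mono (rankTwo_subset (K := K) (L := H))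
  have hν' := hν.mono (rankTwo_subset (K := K) (L := H))
  obtain ⟨M, N, hM, hN, hseg⟩ := hν.exists_isBasic_pair hA hK hH hne
  have hmem_open : ∀ L ∈ rankTwo A K H, M ≠ L → N ≠ L →
      ν L ∈ openSegment ℝ (ν M) (ν N) := fun L hL hML hNL =>
    mem_openSegment_of_ne_left_right (hν'.injOn.ne hM.1 hL hML) (hν'.injOn.ne hN.1 hL hNL)
      (hseg L hL)
  have hH_mem := hmem_open H (right_mem_rankTwo hH) (fun h => hHbasic (h ▸ hM))
    fun h => hHbasic (h ▸ hN)
  have hMN : M ≠ N := fun h => hHbasic <| by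
    rw [h, openSegment_same] at hH_mem
    exact hν'.injOn (right_mem_rankTwo hH) hN.1 hH_mem ▸ hN
  obtain rfl | rfl : M = K ∨ N = K := by
    by_contra! h
    exact hKbasic.notMem_openSegment hA' hν' hM.1 hN.1 h.1 h.2
      (hmem_open K (left_mem_rankTwo hK) h.1 h.2)
  · exact ⟨N, hMN.symm, hN, hH_mem⟩
  · exact ⟨M, hMN, hM, openSegment_symm ℝ (ν M) (ν N) ▸ hH_mem⟩

end Arrangements

/-! ### Shards -/

section Shards

variable {d : ℕ} {A : Set (Submodule ℝ (EuclideanSpace ℝ (Fin d)))}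
  {B : Set (EuclideanSpace ℝ (Fin d))} {b x y z : EuclideanSpace ℝ (Fin d)}
  {ν : Submodule ℝ (EuclideanSpace ℝ (Fin d)) → Dual ℝ (EuclideanSpace ℝ (Fin d))}
  {H H₁ H₁' H₂ K L : Submodule ℝ (EuclideanSpace ℝ (Fin d))}

/-- The hyperplanes of `A` that cut `H`: the ones that separate `H` into shards. -/
def cutters (A : Set (Submodule ℝ (EuclideanSpace ℝ (Fin d)))) (B : Set (EuclideanSpace ℝ (Fin d)))
    (H : Submodule ℝ (EuclideanSpace ℝ (Fin d))) :
    Set (Submodule ℝ (EuclideanSpace ℝ (Fin d))) :=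
  {K | Cuts A B K H}

theorem cutters_subset : cutters A B H ⊆ A := fun _ hK => hK.1

theorem IsArrangement.finite_image_cutters (hA : IsArrangement A) : (ν '' cutters A B H).Finite :=
  (hA.finite.subset cutters_subset).image ν

theorem IsNormalFamily.uncut_eq_regularPoints (hν : IsNormalFamily A B b ν) :
    uncut A B H = regularPoints H (ν '' cutters A B H) :=
  sep_forall_notMem_eq_regularPoints fun K hK => hν.ker_eq K (cutters_subset hK)

theorem Shard.exists_carrier_eq_cell (S : Shard A B) (hν : IsNormalFamily A B b ν) :
    ∃ x ∈ uncut A B S.hyperplane,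
      S.carrier = cell S.hyperplane (ν '' cutters A B S.hyperplane) x := by
  obtain ⟨x, hx, hS⟩ := S.isComponent
  refine ⟨x, hx, hS.trans ?_⟩
  rw [hν.uncut_eq_regularPoints] at hx ⊢
  exact closure_connectedComponentIn_regularPoints hx

theorem Shard.carrier_eq_cell (S : Shard A B) (hν : IsNormalFamily A B b ν)
    (hx : x ∈ S.carrier ∩ uncut A B S.hyperplane) :
    S.carrier = cell S.hyperplane (ν '' cutters A B S.hyperplane) x := by
  obtain ⟨x₀, hx₀, hS⟩ := S.exists_carrier_eq_cell hν
  rw [hS, hν.uncut_eq_regularPoints] at hx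
  rw [hν.uncut_eq_regularPoints] at hx₀
  exact hS.trans (cell_eq_of_mem hx₀ hx).symm

theorem Shard.carrier_subset_hyperplane (S : Shard A B) (hν : IsNormalFamily A B b ν) :
    S.carrier ⊆ S.hyperplane := by
  obtain ⟨x, -, hS⟩ := S.exists_carrier_eq_cell hν
  exact hS ▸ fun y hy => hy.1

theorem Shard.convex_carrier (S : Shard A B) (hν : IsNormalFamily A B b ν) :
    Convex ℝ S.carrier := by
  obtain ⟨x, -, hS⟩ := S.exists_carrier_eq_cell hν
  exact hS ▸ convex_cell

theorem Shard.intrinsicInterior_carrier (S : Shard A B) (hA : IsArrangement A)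
    (hν : IsNormalFamily A B b ν) :
    intrinsicInterior ℝ S.carrier = S.carrier ∩ uncut A B S.hyperplane := by
  obtain ⟨x, hx, hS⟩ := S.exists_carrier_eq_cell hν
  rw [hν.uncut_eq_regularPoints] at hx ⊢
  rw [hS, intrinsicInterior_cell hA.finite_image_cutters hx]

theorem Shard.openSegment_subset_uncut (S : Shard A B) (hν : IsNormalFamily A B b ν)
    (hx : x ∈ S.carrier ∩ uncut A B S.hyperplane) (hy : y ∈ S.carrier) :
    openSegment ℝ x y ⊆ uncut A B S.hyperplane := by
  have hxreg := hx.2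
  rw [S.carrier_eq_cell hν hx] at hy
  rw [hν.uncut_eq_regularPoints] at hxreg ⊢
  exact (openSegment_subset_cell hxreg hy).trans Set.inter_subset_right

theorem exists_shard (hH : H ∈ A) (hx : x ∈ uncut A B H) :
    ∃ S : Shard A B, S.hyperplane = H ∧ x ∈ S.carrier :=
  ⟨⟨H, _, hH, x, hx, rfl⟩, rfl, subset_closure (mem_connectedComponentIn hx)⟩

theorem isBasic_of_mem_uncut (hA : IsArrangement A) (hν : IsNormalFamily A B b ν) (hH : H ∈ A)
    (hL : L ∈ A) (hne : H ≠ L) (hx : x ∈ uncut A B H) (hxL : x ∈ L) :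
    IsBasic (rankTwo A H L) B H := by
  by_contra hbasic
  obtain ⟨K, -, hK, -⟩ := hν.exists_isBasic_pair hA hH hL hne
  have hKH : K ≠ H := fun h => hbasic (h ▸ hK)
  have hrank := rankTwo_eq_of_mem hA hH hL hne hK.1 (left_mem_rankTwo hH) hKH
  exact hx.2 K ⟨hK.1.1, hH, hKH, hrank ▸ hK, hrank ▸ hbasic⟩ (hK.1.2 ⟨hx.1, hxL⟩)

theorem notMem_openSegment_of_mem_uncut (hA : IsArrangement A) (hν : IsNormalFamily A B b ν)
    (hH : H ∈ A) (hx : x ∈ uncut A B H) (hK : K ∈ A) (hL : L ∈ A) (hxK : x ∈ K)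
    (hKH : K ≠ H) (hLH : L ≠ H) : ν H ∉ openSegment ℝ (ν K) (ν L) := by
  intro hseg
  have hLmem : L ∈ rankTwo A H K := by
    refine ⟨hL, fun y hy => (hν.apply_eq_zero_iff hL).1 ?_⟩
    obtain ⟨s, t, -, ht, -, h⟩ := hseg
    have hy' : s * ν K y + t * ν L y = ν H y := by simpa using LinearMap.congr_fun h y
    simpa [(hν.apply_eq_zero_iff hH).2 hy.1, (hν.apply_eq_zero_iff hK).2 hy.2, ht.ne'] using hy'
  exact (isBasic_of_mem_uncut hA hν hH hK hKH.symm hx hxK).notMem_openSegment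
    (hA.mono rankTwo_subset) (hν.mono rankTwo_subset) (right_mem_rankTwo hK) hLmem hKH hLH hseg

theorem mem_simpleSystem_of_mem_uncut (hA : IsArrangement A) (hsimp : IsSimplicial A)
    (hν : IsNormalFamily A B b ν) (hH : H ∈ A) (hx : x ∈ uncut A B H)
    {Δ : Set (Dual ℝ (EuclideanSpace ℝ (Fin d)))}
    (hΔ : IsSimpleSystem {ψ ∈ ν '' A | ψ x = 0} Δ) : ν H ∈ Δ := by
  have hfin : (ν '' A).Finite := hA.finite.image ν
  refine ((hsimp.hasSimpleSystems hA hν.ker_eq).sep_apply_eq_zero hfin x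
    ).mem_of_forall_notMem_openSegment (hfin.subset (Set.sep_subset _ _))
    (fun ψ hψ => hν.image_apply_base ψ hψ.1) hΔ
    ⟨Set.mem_image_of_mem ν hH, (hν.apply_eq_zero_iff hH).2 hx.1⟩ ?_
  rintro _ ⟨⟨K, hK, rfl⟩, hxK⟩ _ ⟨⟨L, hL, rfl⟩, -⟩ hKH hLH
  exact notMem_openSegment_of_mem_uncut hA hν hH hx hK hL ((hν.apply_eq_zero_iff hK).1 hxK)
    (ne_of_apply_ne ν hKH) (ne_of_apply_ne ν hLH)

theorem inf_le_of_cuts (hA : IsArrangement A) (hsimp : IsSimplicial A)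
    (hν : IsNormalFamily A B b ν) (h₁ : H₁ ∈ A) (h₁' : H₁' ∈ A) (h₂ : H₂ ∈ rankTwo A H₁ H₁')
    (hz : z ∈ uncut A B H₁) (hz' : z ∈ uncut A B H₁') (hK : Cuts A B K H₂) (hzK : z ∈ K) :
    H₁ ⊓ H₁' ≤ K := by
  have hmem : ∀ M ∈ A, z ∈ M → ν M ∈ {ψ ∈ ν '' A | ψ z = 0} := fun M hM hzM =>
    ⟨Set.mem_image_of_mem ν hM, (hν.apply_eq_zero_iff hM).2 hzM⟩
  obtain ⟨Δ, hΔ⟩ := ((hsimp.hasSimpleSystems hA hν.ker_eq).sep_apply_eq_zero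
    (hA.finite.image ν) z).exists_isSimpleSystem (b := b) fun ψ hψ => by
      rw [hν.image_apply_base ψ hψ.1]; exact one_pos
  have hpair : {ν H₁, ν H₁'} ⊆ Δ :=
    Set.pair_subset (mem_simpleSystem_of_mem_uncut hA hsimp hν h₁ hz hΔ)
      (mem_simpleSystem_of_mem_uncut hA hsimp hν h₁' hz' hΔ)
  have hH₂ : ν H₂ ∈ Submodule.span ℝ {ν H₁, ν H₁'} := by
    obtain ⟨t, ht⟩ := hν.exists_eq_lineMap h₁ h₁' h₂
    exact Submodule.mem_span_pair.2
      ⟨1 - t, t, by rw [ht, AffineMap.lineMap_apply_module]⟩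
  obtain ⟨L, -, hL, hseg⟩ := hK.exists_mem_openSegment hA hν
  have hhull := hΔ.mem_hull_of_mem_openSegment hpair (hmem K hK.1 hzK)
    (hmem L hL.1.1 (hL.1.2 ⟨hzK, h₂.2 ⟨hz.1, hz'.1⟩⟩)) hH₂ hseg
  intro y hy
  obtain ⟨s, t, hst⟩ := Submodule.mem_span_pair.1 (PointedCone.hull_le_span ℝ _ hhull)
  refine (hν.apply_eq_zero_iff hK.1).1 ?_
  simp [← hst, (hν.apply_eq_zero_iff h₁).2 hy.1, (hν.apply_eq_zero_iff h₁').2 hy.2]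

theorem Shard.inter_carrier_subset_of_mem {S₁ S₁' S₂ : Shard A B} (hA : IsArrangement A)
    (hsimp : IsSimplicial A) (hν : IsNormalFamily A B b ν)
    (h₂ : S₂.hyperplane ∈ rankTwo A S₁.hyperplane S₁'.hyperplane)
    (hx : x ∈ S₁.carrier ∩ uncut A B S₁.hyperplane)
    (hx' : x ∈ S₁'.carrier ∩ uncut A B S₁'.hyperplane) (hx₂ : x ∈ S₂.carrier) :
    S₁.carrier ∩ S₁'.carrier ⊆ S₂.carrier := by
  rintro y ⟨hy, hy'⟩
  have hy_inf : y ∈ S₁.hyperplane ⊓ S₁'.hyperplane :=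
    ⟨S₁.carrier_subset_hyperplane hν hy, S₁'.carrier_subset_hyperplane hν hy'⟩
  obtain ⟨x₀, hx₀, hS₂⟩ := S₂.exists_carrier_eq_cell hν
  rw [hS₂] at hx₂ ⊢
  refine ⟨h₂.2 hy_inf, fun φ hφ => not_lt.1 fun hφy => ?_⟩
  obtain ⟨K, hK, hφK⟩ : ∃ K, Cuts A B K S₂.hyperplane ∧ ∀ w, φ w = 0 ↔ w ∈ K := by
    rcases hφ.1 with ⟨K, hK, rfl⟩ | ⟨K, hK, hKφ⟩
    · exact ⟨K, hK, fun w => hν.apply_eq_zero_iff hK.1⟩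
    · exact ⟨K, hK, fun w => by
        rw [← hν.apply_eq_zero_iff hK.1, hKφ, LinearMap.neg_apply, neg_eq_zero]⟩
  have hφ_ne : ∀ z ∈ uncut A B S₁.hyperplane, z ∈ uncut A B S₁'.hyperplane → φ z ≠ 0 :=
    fun z hz hz' hφz => hφy.ne <| (hφK y).2 <| inf_le_of_cuts hA hsimp hν S₁.hyperplane_mem
      S₁'.hyperplane_mem h₂ hz hz' hK ((hφK z).1 hφz) hy_inf
  have hφx : 0 < φ x := (hx₂.2 φ hφ).lt_of_ne' (hφ_ne x hx.2 hx'.2)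
  obtain ⟨z, hz, hφz⟩ := exists_openSegment_apply_eq_zero hφx hφy
  exact hφ_ne z (S₁.openSegment_subset_uncut hν hx hy hz)
    (S₁'.openSegment_subset_uncut hν hx' hy' hz) hφz

theorem mem_uncut_of_isBasic (hA : IsArrangement A) (h₁ : H₁ ∈ A) (h₂ : H₂ ∈ A) (hne : H₁ ≠ H₂)
    (hH : IsBasic (rankTwo A H₁ H₂) B H) (hx : x ∈ H₁ ⊓ H₂)
    (hgeneric : ∀ K ∈ A, x ∈ K → H₁ ⊓ H₂ ≤ K) : x ∈ uncut A B H := by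
  refine ⟨hH.1.2 hx, fun K ⟨hK, _, hKH, _, hbasic⟩ hxK => hbasic ?_⟩
  rwa [rankTwo_eq_of_mem hA h₁ h₂ hne ⟨hK, hgeneric K hK hxK⟩ hH.1 hKH]

theorem Shard.exists_generic_mem_inter_carrier {S₁ S₂ : Shard A B} (hA : IsArrangement A)
    (hν : IsNormalFamily A B b ν) (hne : S₁.hyperplane ≠ S₂.hyperplane)
    (hcodim : HasCodim (S₁.carrier ∩ S₂.carrier) 2) :
    ∃ x ∈ S₁.carrier ∩ S₂.carrier, ∀ K ∈ A, x ∈ K → S₁.hyperplane ⊓ S₂.hyperplane ≤ K := by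
  obtain ⟨x, hx, hxK⟩ := exists_mem_forall_notMem_of_convex
    ((S₁.convex_carrier hν).inter (S₂.convex_carrier hν)) hcodim.1
    (hA.finite.subset (Set.sep_subset A fun K => ¬ S₁.hyperplane ⊓ S₂.hyperplane ≤ K))
    fun K hK hsub => hK.2 <| hcodim.le_of_subset
      (finrank_inf_add_two (hA.isHyperplane _ S₁.hyperplane_mem)
        (hA.isHyperplane _ S₂.hyperplane_mem) hne)
      (Set.inter_subset_inter (S₁.carrier_subset_hyperplane hν) (S₂.carrier_subset_hyperplane hν))
      hsub
  exact ⟨x, hx, fun K hK hmem => by_contra fun hle => hxK K ⟨hK, hle⟩ hmem⟩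

theorem Shard.exists_compatible_of_adj {S₁ S₂ : Shard A B} (hA : IsArrangement A)
    (hsimp : IsSimplicial A) (hν : IsNormalFamily A B b ν)
    (hadj : (shardDigraph A B).Adj S₁ S₂) :
    ∃ S₁' : Shard A B, S₁.Compatible S₁' ∧
      (S₁.hyperplane ≠ S₁'.hyperplane ∧
        S₂.hyperplane ∈ rankTwo A S₁.hyperplane S₁'.hyperplane ∧
        ¬ IsBasic (rankTwo A S₁.hyperplane S₁'.hyperplane) B S₂.hyperplane) ∧
      S₁.carrier ∩ S₁'.carrier ⊆ S₂.carrier := by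
  obtain ⟨hcuts, hcodim⟩ := hadj
  obtain ⟨H₁', hne', hbasic', -⟩ := hcuts.exists_mem_openSegment hA hν
  obtain ⟨h₁, h₂, hne, hbasic, hnonbasic⟩ := hcuts
  have hrank := rankTwo_eq_of_mem hA h₁ h₂ hne (left_mem_rankTwo h₁) hbasic'.1 hne'.symm
  obtain ⟨x, hx, hgeneric⟩ := Shard.exists_generic_mem_inter_carrier hA hν hne hcodim
  have hx_inf : x ∈ S₁.hyperplane ⊓ S₂.hyperplane :=
    ⟨S₁.carrier_subset_hyperplane hν hx.1, S₂.carrier_subset_hyperplane hν hx.2⟩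
  have huncut := mem_uncut_of_isBasic hA h₁ h₂ hne hbasic hx_inf hgeneric
  have huncut' := mem_uncut_of_isBasic hA h₁ h₂ hne hbasic' hx_inf hgeneric
  obtain ⟨S₁', rfl, hxS₁'⟩ := exists_shard hbasic'.1.1 huncut'
  have hmem : S₂.hyperplane ∈ rankTwo A S₁.hyperplane S₁'.hyperplane :=
    hrank ▸ right_mem_rankTwo h₂
  refine ⟨S₁', ⟨x, ?_, ?_⟩, ⟨hne'.symm, hmem, hrank ▸ hnonbasic⟩,
    Shard.inter_carrier_subset_of_mem hA hsimp hν hmem ⟨hx.1, huncut⟩ ⟨hxS₁', huncut'⟩ hx.2⟩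
  · rw [S₁.intrinsicInterior_carrier hA hν]; exact ⟨hx.1, huncut⟩
  · rw [S₁'.intrinsicInterior_carrier hA hν]; exact ⟨hxS₁', huncut'⟩

theorem Shard.hasCodim_two_of_subset_of_subset {S S' : Shard A B}
    (hA : IsArrangement A) (hν : IsNormalFamily A B b ν) (hne : S.hyperplane ≠ S'.hyperplane)
    (hx : x ∈ S.carrier ∩ uncut A B S.hyperplane)
    (hx' : x ∈ S'.carrier ∩ uncut A B S'.hyperplane) {C : Set (EuclideanSpace ℝ (Fin d))}
    (hSC : S.carrier ∩ S'.carrier ⊆ C)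
    (hC : C ⊆ (S.hyperplane ⊓ S'.hyperplane : Submodule ℝ (EuclideanSpace ℝ (Fin d)))) :
    HasCodim C 2 := by
  refine hasCodim_of_cell_subset
    (finrank_inf_add_two (hA.isHyperplane _ S.hyperplane_mem)
      (hA.isHyperplane _ S'.hyperplane_mem) hne)
    (hA.finite_image_cutters.union hA.finite_image_cutters) ⟨hx.2.1, hx'.2.1⟩
    (Set.Subset.trans ?_ hSC) hC
    (Ψ := ν '' cutters A B S.hyperplane ∪ ν '' cutters A B S'.hyperplane)
  rw [S.carrier_eq_cell hν hx, S'.carrier_eq_cell hν hx']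
  exact fun y hy => ⟨⟨hy.1.1, fun φ hφ => hy.2 φ ⟨hφ.1.imp .inl .inl, hφ.2⟩⟩,
    hy.1.2, fun φ hφ => hy.2 φ ⟨hφ.1.imp .inr .inr, hφ.2⟩⟩

theorem Shard.adj_of_compatible {S₁ S₁' S₂ : Shard A B} (hA : IsArrangement A)
    (hν : IsNormalFamily A B b ν) (hcomp : S₁.Compatible S₁')
    (hne : S₁.hyperplane ≠ S₁'.hyperplane)
    (hmem : S₂.hyperplane ∈ rankTwo A S₁.hyperplane S₁'.hyperplane)
    (hnonbasic : ¬ IsBasic (rankTwo A S₁.hyperplane S₁'.hyperplane) B S₂.hyperplane)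
    (hsub : S₁.carrier ∩ S₁'.carrier ⊆ S₂.carrier) : (shardDigraph A B).Adj S₁ S₂ := by
  obtain ⟨x, hx, hx'⟩ := hcomp
  rw [Shard.intrinsicInterior_carrier _ hA hν] at hx hx'
  have h₁ := S₁.hyperplane_mem
  have h₁' := S₁'.hyperplane_mem
  have hbasic := isBasic_of_mem_uncut hA hν h₁ h₁' hne hx.2 hx'.2.1
  have hne₂ : S₁.hyperplane ≠ S₂.hyperplane := fun h => hnonbasic (h ▸ hbasic)
  have hrank := rankTwo_eq_of_mem hA h₁ h₁' hne (left_mem_rankTwo h₁) hmem hne₂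
  have hS₁' : S₁'.hyperplane ∈ rankTwo A S₁.hyperplane S₂.hyperplane :=
    hrank ▸ right_mem_rankTwo h₁'
  refine ⟨⟨h₁, S₂.hyperplane_mem, hne₂, hrank ▸ hbasic, hrank ▸ hnonbasic⟩,
    Shard.hasCodim_two_of_subset_of_subset hA hν hne hx hx' (fun y hy => ⟨hy.1, hsub hy⟩) ?_⟩
  exact fun y hy => ⟨S₁.carrier_subset_hyperplane hν hy.1, hS₁'.2
    ⟨S₁.carrier_subset_hyperplane hν hy.1, S₂.carrier_subset_hyperplane hν hy.2⟩⟩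

end Shards

end HypArr

theorem mainTheorem2 {d : ℕ} (A : Set (Submodule ℝ (EuclideanSpace ℝ (Fin d))))
    (hA : HypArr.IsArrangement A) (hsimp : HypArr.IsSimplicial A)
    (B : Set (EuclideanSpace ℝ (Fin d))) (hB : HypArr.IsRegion A B)
    (S₁ S₂ : HypArr.Shard A B) :
    (HypArr.shardDigraph A B).Adj S₁ S₂ ↔
      ∃ S₁' : HypArr.Shard A B,
        S₁.Compatible S₁' ∧
        (S₁.hyperplane ≠ S₁'.hyperplane ∧
          S₂.hyperplane ∈ HypArr.rankTwo A S₁.hyperplane S₁'.hyperplane ∧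
          ¬ HypArr.IsBasic (HypArr.rankTwo A S₁.hyperplane S₁'.hyperplane) B S₂.hyperplane) ∧
        S₁.carrier ∩ S₁'.carrier ⊆ S₂.carrier := by
  obtain ⟨b, ν, hν⟩ := hB.exists_isNormalFamily hA
  exact ⟨HypArr.Shard.exists_compatible_of_adj hA hsimp hν,
    fun ⟨_, hcomp, ⟨hne, hmem, hnonbasic⟩, hsub⟩ =>
      HypArr.Shard.adj_of_compatible hA hν hcomp hne hmem hnonbasic hsub⟩
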